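/- Fix an integer $d\ge2$. Words are over the alphabet $\{a,b\}$; $\mathbb N=\{1,2,3,\dots\}$. Let $F_{d,\infty}$ be the cutting sequence of the half line $y=\theta x$, $x>0$, with slope $\theta=[0;d,d,d,\dots]$: reading its intersections with the integer grid from left to right, write $a$ for a vertical grid line and $b$ for a horizontal one. For $k\ge1$ let $\sigma_k$ be the substitution $a\mapsto a^kb$, $b\mapsto a$. Put $F_{d,m}=\sigma_d^m(a)$ for $m\ge0$, $F_{d,-1}=b$, $f_{d,m}=|F_{d,m}|$, and let $\delta_m$ be the last letter of $F_{d,m}$ ($m\ge -1$). For $m\ge0$ and $0\le i\le d-1$ let $$K_{d,m,i}=\delta_m\,F_{d,m}^{\,i}\,F_{d,m-1}\,\delta_{m-1}^{-1},$$ where $\delta_{m-1}^{-1}$ removes the last letter. For a nonempty factor $\omega$ of $F_{d,\infty}$, $\mathrm{Ker}(\omega)=K_{d,m,i}$ means that $(m,i)$ is the lexicographically greatest pair for which $K_{d,m,i}$ is a factor of $\omega$; $m$ is then called the order of the kernel. Write $F_{d,\infty}=x_1x_2\cdots$ and let $\omega_p$ ($p\ge1$) be the $p$-th occurrence of $\omega$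 in $F_{d,\infty}$. If $\omega_p=x_{s+1}\cdots x_{s+n}$ and $\omega_{p+1}=x_{t+1}\cdots x_{t+n}$, then $\omega_p,\omega_{p+1}$ are adjacent if $s+n=t$, with gap $G_p(\omega)=\varepsilon$; separated if $s+n<t$, with gap $G_p(\omega)=x_{s+n+1}\cdots x_t$; overlapped if $s+n>t$, with gap $G_p(\omega)=(x_{t+1}\cdots x_{s+n})^{-1}$. A gap is called $=0$, $>0$, $<0$ in these three cases, respectively. Let $\mathcal P_1,\mathcal S_1,\mathcal O_1$ be the sets of pairs $(\omega,p)$, with $\omega$ a factor of $F_{d,\infty}$ and $p\ge1$, for which $\omega_p$ and $\omega_{p+1}$ are adjacent, separated, overlapped, respectively. Let $G_A(\omega)=G_1(\omega)$ and $G_B(\omega)=G_q(\omega)$ with $q=\min\{p\ge1:G_p(\omega)\ne G_1(\omega)\}$. For $m\ge1$ define the following sets of factors $\omega$ of $F_{d,\infty}$. * With $\mathrm{Ker}(\omega)=K_{d,m,0}$: $T_{0,1}$ ($G_A>0$, $G_B>0$), $T_{0,2}$ ($G_A=0$, $G_B>0$), $T_{0,3}$ ($G_A<0$, $G_B>0$),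 $T_{0,4}$ ($G_A<0$, $G_B=0$), $T_{0,5}$ ($G_A<0$, $G_B<0$). * With $\mathrm{Ker}(\omega)=K_{d,m,i}$, for $1\le i\le d-2$: $T_{i,1}$ ($G_A<0$, $G_B>0$), $T_{i,2}$ ($G_A<0$, $G_B=0$), $T_{i,3}$ ($G_A<0$, $G_B<0$). * With $\mathrm{Ker}(\omega)=K_{d,m,d-1}$: $T_{d-1,1}$ ($G_A>0$, $G_B<0$), $T_{d-1,2}$ ($G_A=0$, $G_B<0$), $T_{d-1,3}$ ($G_A<0$, $G_B<0$). For $\gamma\in\{a,b\}$ let $\Gamma_{i,\gamma}$ be the set of $p\ge1$ such that the $p$-th letter of $\sigma_{d-i-1}(F_{d,\infty})$ is $\gamma$ when $0\le i\le d-2$, and such that the $p$-th letter of $F_{d,\infty}$ is $\gamma$ when $i=d-1$. **Theorem.** Let $d\ge2$ and $m\ge1$. Among the pairs $(\omega,p)$ for which the kernel of $\omega$ has order $m$: 1. $\mathcal P_1=(T_{0,2}\times\Gamma_{0,a})\cup(T_{0,4}\times\Gamma_{0,b})\cup\bigcup_{i=1}^{d-2}(T_{i,2}\times\Gamma_{i,b})\cup(T_{d-1,2}\times\Gamma_{d-1,a})$;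 2. $\mathcal S_1=(T_{0,1}\times\mathbb N)\cup\big((T_{0,2}\cup T_{0,3})\times\Gamma_{0,b}\big)\cup\bigcup_{i=1}^{d-2}(T_{i,1}\times\Gamma_{i,b})\cup(T_{d-1,1}\times\Gamma_{d-1,a})$; 3. $\mathcal O_1=\big((T_{0,3}\cup T_{0,4})\times\Gamma_{0,a}\big)\cup\bigcup_{i=1}^{d-2}\big((T_{i,1}\cup T_{i,2})\times\Gamma_{i,a}\big)\cup\Big(\big(\bigcup_{i=1}^{d-2}T_{i,3}\cup T_{0,5}\cup T_{d-1,3}\big)\times\mathbb N\Big)\cup\big((T_{d-1,1}\cup T_{d-1,2})\times\Gamma_{d-1,b}\big)$. Moreover, every factor $\omega$ of $F_{d,\infty}$ with $\mathrm{Ker}(\omega)=K_{d,m,i}$ has an expression $$\omega=F_{d,m}[x,f_{d,m}-1]\;K_{d,m,i}\;(\delta_{m+1}F_{d,m})[1,y],\qquad 1\le x\le f_{d,m},\ 0\le y\le f_{d,m}-1,\tag{$\star$}$$ where $u[r,s]$ is the word formed by the letters of $u$ with numbers $r,\dots,s$ (empty if $s=r-1$), and for every such expression: * if $i=0$: $\omega\in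 T_{0,1}\Leftrightarrow f_{d,m-1}<x-y\le f_{d,m}$; $\omega\in T_{0,2}\Leftrightarrow x-y=f_{d,m-1}$; $\omega\in T_{0,3}\Leftrightarrow 0<x-y<f_{d,m-1}$; $\omega\in T_{0,4}\Leftrightarrow x-y=0$; $\omega\in T_{0,5}\Leftrightarrow 2-f_{d,m}\le x-y<0$; * if $1\le i\le d-2$ or $i=d-1\ge1$: $\omega\in T_{i,1}\Leftrightarrow 0<x-y\le f_{d,m}$; $\omega\in T_{i,2}\Leftrightarrow x-y=0$; $\omega\in T_{i,3}\Leftrightarrow 2-f_{d,m}\le x-y<0$. -/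

import Mathlib

namespace CutSeq

/-! Words, substitutions and the cutting sequence -/

inductive Letter : Type where
  | a : Letter
  | b : Letter

open Letter

/-- The slope `[0; d, d, d, …]`, i.e. the positive root of `θ = 1 / (d + θ)`. -/
noncomputable def slope (d : ℕ) : ℝ := (Real.sqrt ((d : ℝ) ^ 2 + 4) - d) / 2

theorem slope_pos (d : ℕ) : 0 < slope d := by
  have h : (d : ℝ) < Real.sqrt ((d : ℝ) ^ 2 + 4) :=
    Real.lt_sqrt_of_sq_lt (by linarith)
  unfold slope
  linarith

theorem slope_eq (d : ℕ) : slope d = 1 / ((d : ℝ) + slope d) := by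
  have hp := slope_pos d
  have hs : Real.sqrt ((d : ℝ) ^ 2 + 4) ^ 2 = (d : ℝ) ^ 2 + 4 :=
    Real.sq_sqrt (by positivity)
  have hd : (0 : ℝ) < (d : ℝ) + slope d := by positivity
  rw [eq_div_iff hd.ne']
  unfold slope
  nlinarith

/-- Abscissae of the points of the half line `y = θ x`, `x > 0`, that lie on a vertical line
`x = k` or on a horizontal line `y = l` of the integer grid. -/
def crossings (θ : ℝ) : Set ℝ :=
  {x | 0 < x ∧ ((∃ k : ℤ, x = k) ∨ ∃ l : ℤ, θ * x = l)}

/-- The cutting sequence of slope `θ`. Infinite words are functions on `ℕ`; the value at `n` is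
the letter number `n + 1`. That letter is `a` when the crossing number `n + 1`, from left to
right, is with a vertical line, and `b` otherwise. -/
noncomputable def cuttingSeq (θ : ℝ) (n : ℕ) : Letter :=
  open Classical in
  if ∃ x ∈ crossings θ, (crossings θ ∩ Set.Iic x).ncard = n + 1 ∧ ∃ k : ℤ, x = k then a else b

/-- The sequence `F_{d,∞}`. -/
noncomputable def Finf (d : ℕ) : ℕ → Letter := cuttingSeq (slope d)

/-- The substitution `σ_k`: `a ↦ a^k b`, `b ↦ a`. -/
def sigma (k : ℕ) : Letter → List Letter
  | a => List.replicate k a ++ [b]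
  | b => [a]

/-- The image `σ_k(w)` of an infinite word: its letter number `n + 1` is that of the image of the
first `n + 1` letters of `w`, an image of length at least `n + 1`. -/
def sigmaInf (k : ℕ) (w : ℕ → Letter) (n : ℕ) : Letter :=
  (((List.range (n + 1)).map w).flatMap (sigma k)).getD n a

/-- `F_{d,m} = σ_d^m(a)`. -/
def F (d m : ℕ) : List Letter := (fun u : List Letter => u.flatMap (sigma d))^[m] [a]

/-- `F_{d,m-1}`, with `F_{d,-1} = b` (so that `F_{d,1} = F_{d,0}^d F_{d,-1}`). -/
def Fpred (d : ℕ) : ℕ → List Letter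
  | 0 => [b]
  | m + 1 => F d m

/-- `f_{d,m}`, the length of `F_{d,m}`. -/
def f (d m : ℕ) : ℕ := (F d m).length

/-- `δ_m`, the last letter of the (nonempty) word `F_{d,m}`. -/
def delta (d m : ℕ) : Letter := (F d m).getLastD a

/-- The kernel word `K_{d,m,i} = δ_m F_{d,m}^i F_{d,m-1} δ_{m-1}⁻¹`; the last factor removes the
last letter of `F_{d,m-1}`. -/
def K (d m i : ℕ) : List Letter :=
  delta d m :: ((List.replicate i (F d m)).flatten ++ (Fpred d m).dropLast)

/-! Occurrences and gaps -/

/-- `u` is preceded by exactly `i` letters at one of its occurrences in `w`, that is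
`u = x_{i+1} ⋯ x_{i+n}` where `w = x_1 x_2 ⋯` and `n = |u|`. -/
def OccursAfter (w : ℕ → Letter) (u : List Letter) (i : ℕ) : Prop :=
  (List.range u.length).map (fun k => w (i + k)) = u

/-- `u` is a factor of the infinite word `w`. -/
def IsFactor (w : ℕ → Letter) (u : List Letter) : Prop := ∃ i, OccursAfter w u i

/-- The number of letters of `w` before the `p`-th occurrence `u_p` of `u`, for `p ≥ 1`. -/
noncomputable def offset (w : ℕ → Letter) (u : List Letter) (p : ℕ) : ℕ :=
  Nat.nth (OccursAfter w u) (p - 1)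

def Adjacent (w : ℕ → Letter) (u : List Letter) (p : ℕ) : Prop :=
  offset w u p + u.length = offset w u (p + 1)

def Separated (w : ℕ → Letter) (u : List Letter) (p : ℕ) : Prop :=
  offset w u p + u.length < offset w u (p + 1)

def Overlapped (w : ℕ → Letter) (u : List Letter) (p : ℕ) : Prop :=
  offset w u (p + 1) < offset w u p + u.length

/-- Gaps are the empty word, a nonempty word `u`, or the inverse `u⁻¹` of a nonempty word. -/
inductive Gap : Type where
  | empty : Gap
  | word (u : List Letter) : Gap
  | inv (u : List Letter) : Gap

/-- The sign of the length of a gap; inverse words have negative length. -/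
def Gap.sign : Gap → ℤ
  | .empty => 0
  | .word _ => 1
  | .inv _ => -1

/-- The word `x_{i+1} ⋯ x_j`, where `w = x_1 x_2 ⋯`. -/
def segment (w : ℕ → Letter) (i j : ℕ) : List Letter :=
  (List.range (j - i)).map (fun k => w (i + k))

/-- The gap `G_p(u)` between the occurrences `u_p` and `u_{p+1}`. -/
noncomputable def gap (w : ℕ → Letter) (u : List Letter) (p : ℕ) : Gap :=
  if offset w u p + u.length = offset w u (p + 1) then .empty
  else if offset w u p + u.length < offset w u (p + 1) then
    .word (segment w (offset w u p + u.length) (offset w u (p + 1)))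
  else .inv (segment w (offset w u (p + 1)) (offset w u p + u.length))

/-- `G_A(u)`, the first gap. -/
noncomputable def gapA (w : ℕ → Letter) (u : List Letter) : Gap := gap w u 1

/-- `G_B(u)`, the first gap that differs from the first one. -/
noncomputable def gapB (w : ℕ → Letter) (u : List Letter) : Gap :=
  gap w u (sInf {p | 1 ≤ p ∧ gap w u p ≠ gap w u 1})

/-! Kernels and types of factors -/

/-- `Ker(u) = K_{d,m,i}`: the greatest kernel word in `u`, for the lexicographic order of the
pairs (order, type). -/
def IsKer (d : ℕ) (u : List Letter) (m i : ℕ) : Prop :=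
  i < d ∧ K d m i <:+: u ∧
    ∀ n j, j < d → K d n j <:+: u → n < m ∨ (n = m ∧ j ≤ i)

/-- The expression `u = F_{d,m}[x, f_{d,m} - 1] K_{d,m,i} (δ_{m+1} F_{d,m})[1, y]`. -/
def HasExpr (d m i : ℕ) (u : List Letter) (x y : ℕ) : Prop :=
  1 ≤ x ∧ x ≤ f d m ∧ y ≤ f d m - 1 ∧
    u = (F d m).dropLast.drop (x - 1) ++ K d m i ++ (delta d (m + 1) :: F d m).take y

/-- The factors of `F_{d,∞}` with kernel `K_{d,m,i}` whose gaps `G_A` and `G_B` have the signs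
`sA` and `sB`. -/
def signType (d m i : ℕ) (sA sB : ℤ) : Set (List Letter) :=
  {u | IsFactor (Finf d) u ∧ IsKer d u m i ∧
    (gapA (Finf d) u).sign = sA ∧ (gapB (Finf d) u).sign = sB}

/-- The types `T_{0,1}, …, T_{0,5}`, for kernels of order `m`. -/
def T01 (d m : ℕ) : Set (List Letter) := signType d m 0 1 1
def T02 (d m : ℕ) : Set (List Letter) := signType d m 0 0 1
def T03 (d m : ℕ) : Set (List Letter) := signType d m 0 (-1) 1
def T04 (d m : ℕ) : Set (List Letter) := signType d m 0 (-1) 0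
def T05 (d m : ℕ) : Set (List Letter) := signType d m 0 (-1) (-1)

/-- The types `T_{i,1}, T_{i,2}, T_{i,3}`, used for `1 ≤ i ≤ d - 2`. -/
def Ti1 (d m i : ℕ) : Set (List Letter) := signType d m i (-1) 1
def Ti2 (d m i : ℕ) : Set (List Letter) := signType d m i (-1) 0
def Ti3 (d m i : ℕ) : Set (List Letter) := signType d m i (-1) (-1)

/-- The types `T_{d-1,1}, T_{d-1,2}, T_{d-1,3}`. -/
def Td1 (d m : ℕ) : Set (List Letter) := signType d m (d - 1) 1 (-1)
def Td2 (d m : ℕ) : Set (List Letter) := signType d m (d - 1) 0 (-1)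
def Td3 (d m : ℕ) : Set (List Letter) := signType d m (d - 1) (-1) (-1)

/-- The index set `Γ_{i,γ}` of `p ≥ 1` such that the letter number `p` of `σ_{d-i-1}(F_{d,∞})`
(for `i ≤ d - 2`) or of `F_{d,∞}` (for `i = d - 1`) is `γ`. -/
def Gam (d i : ℕ) (γ : Letter) : Set ℕ :=
  {p | 1 ≤ p ∧ (if i = d - 1 then Finf d else sigmaInf (d - i - 1) (Finf d)) (p - 1) = γ}

/-- The set of all indices `p ≥ 1`. -/
def allIdx : Set ℕ := {p | 1 ≤ p}

/-- Pairs `(u, p)` such that `u_p` and `u_{p+1}` are adjacent. -/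
def P1 (d : ℕ) : Set (List Letter × ℕ) :=
  {q | IsFactor (Finf d) q.1 ∧ 1 ≤ q.2 ∧ Adjacent (Finf d) q.1 q.2}

/-- Pairs `(u, p)` such that `u_p` and `u_{p+1}` are separated. -/
def S1 (d : ℕ) : Set (List Letter × ℕ) :=
  {q | IsFactor (Finf d) q.1 ∧ 1 ≤ q.2 ∧ Separated (Finf d) q.1 q.2}

/-- Pairs `(u, p)` such that `u_p` and `u_{p+1}` are overlapped. -/
def O1 (d : ℕ) : Set (List Letter × ℕ) :=
  {q | IsFactor (Finf d) q.1 ∧ 1 ≤ q.2 ∧ Overlapped (Finf d) q.1 q.2}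

/-- Pairs `(u, p)` such that the kernel of `u` has order `m`. -/
def kerOrder (d m : ℕ) : Set (List Letter × ℕ) := {q | ∃ i, IsKer d q.1 m i}

end CutSeq

namespace CutSeq

open Letter

/-! ### Prefixes and occurrences -/

/-! The slope satisfies `θ² + dθ = 1`, and counting grid crossings shows that the cutting sequence
is fixed by `σ_d` (`isFixed_Finf`). Hence for every `m` it is a concatenation of blocks `F_{d,m}`
and `F_{d,m-1}`, the images under `σ_d^m` of its letters `a` and `b`; `pos d w m n` is the place
where block number `n`, counted from `0`, starts.

Kernel words synchronise with these blocks. Undoing `σ_d` one level at a time shows that `K_{d,m,i}`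
occurs exactly where a run of `i + 1` letters `a` occurs at level `m` (`IsFixed.occursAfter_K`). A
factor `u` with this kernel extends it by fewer than `f_{d,m}` letters on either side, since
otherwise it would contain `K_{d,m,i+1}` or `K_{d,m+1,0}` (`IsFixed.exists_expr`). The added letters
are forced: on the left they lie in one block `F_{d,m}`, on the right they lie in the common prefix
of `F_{d,m}F_{d,m-1}` and `F_{d,m-1}F_{d,m}`. So the occurrences of `u` correspond, by a fixed
shift, to those of `a^{i+1}` (`IsFixed.occursAfter_expr`).

The latter are coded through `σ_d = τ_i ∘ σ_{d-i-1}`, where `τ_i` is `a ↦ a`, `b ↦ a^{i+1}b`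
(`flatMap_sigma_tau`): the letters of `σ_{d-i-1}(F_{d,∞})` list the successive return steps. A
letter `a` gives the distance `f_{d,m}`, a letter `b` the distance `(i+1)f_{d,m} + f_{d,m-1}`. Since
`|u| = (i+1)f_{d,m} + f_{d,m-1} + y - x`, the two signed gap lengths are `x - y - i f_{d,m} -
f_{d,m-1}` and `x - y`, and everything reduces to their signs. For `i = d - 1` the coding uses
`σ_0`, which exchanges the letters; this is why `a` and `b` trade roles in the last family. -/

/-- The prefix of length `n` of an infinite word. -/
def pre (w : ℕ → Letter) (n : ℕ) : List Letter := (List.range n).map w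

@[simp] theorem length_pre (w : ℕ → Letter) (n : ℕ) : (pre w n).length = n := by simp [pre]

@[simp] theorem pre_zero (w : ℕ → Letter) : pre w 0 = [] := rfl

theorem pre_succ (w : ℕ → Letter) (n : ℕ) : pre w (n + 1) = pre w n ++ [w n] := by
  simp [pre, List.range_succ]

theorem occursAfter_iff {w : ℕ → Letter} {u : List Letter} {s : ℕ} :
    OccursAfter w u s ↔ ∀ k (h : k < u.length), w (s + k) = u[k] := by
  unfold OccursAfter
  constructor
  · intro h k hk
    have h2 := congrArg (fun l => l[k]?) h
    simpa [hk] using h2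
  · intro h
    apply List.ext_getElem (by simp)
    intro k h1 h2
    simpa using h k h2

theorem occursAfter_append {w : ℕ → Letter} {u v : List Letter} {s : ℕ} :
    OccursAfter w (u ++ v) s ↔ OccursAfter w u s ∧ OccursAfter w v (s + u.length) := by
  unfold OccursAfter
  rw [List.length_append, List.range_add, List.map_append, List.map_map]
  constructor
  · intro h
    obtain ⟨h1, h2⟩ := List.append_inj h (by simp)
    exact ⟨h1, by simpa [Function.comp_def, add_assoc] using h2⟩
  · rintro ⟨h1, h2⟩
    rw [h1]
    congr 1
    simpa [Function.comp_def, add_assoc] using h2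

@[simp] theorem occursAfter_nil (w : ℕ → Letter) (s : ℕ) : OccursAfter w [] s := by
  simp [OccursAfter]

@[simp] theorem occursAfter_singleton {w : ℕ → Letter} {c : Letter} {s : ℕ} :
    OccursAfter w [c] s ↔ w s = c := by
  simp [OccursAfter]

theorem occursAfter_cons {w : ℕ → Letter} {c : Letter} {u : List Letter} {s : ℕ} :
    OccursAfter w (c :: u) s ↔ w s = c ∧ OccursAfter w u (s + 1) := by
  rw [← List.singleton_append, occursAfter_append]
  simp

theorem occursAfter_replicate {w : ℕ → Letter} {c : Letter} {r s : ℕ} :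
    OccursAfter w (List.replicate r c) s ↔ ∀ k < r, w (s + k) = c := by
  simp [occursAfter_iff]

/-- In terms of prefixes an occurrence becomes an identity between finite words, to which
substitutions can be applied. -/
theorem occursAfter_iff_pre {w : ℕ → Letter} {u : List Letter} {s : ℕ} :
    OccursAfter w u s ↔ pre w (s + u.length) = pre w s ++ u := by
  unfold OccursAfter pre
  rw [List.range_add, List.map_append, List.append_cancel_left_eq, List.map_map]
  rfl

theorem OccursAfter.of_prefix {w : ℕ → Letter} {u v : List Letter} {s : ℕ}
    (h : OccursAfter w v s) (huv : u <+: v) : OccursAfter w u s := by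
  obtain ⟨t, rfl⟩ := huv
  exact (occursAfter_append.1 h).1

theorem OccursAfter.eq_of_length {w : ℕ → Letter} {u v : List Letter} {s : ℕ}
    (hu : OccursAfter w u s) (hv : OccursAfter w v s) (h : u.length = v.length) : u = v := by
  unfold OccursAfter at hu hv
  rw [← hu, ← hv, h]

/-- A word that occurs inside an occurrence of `u` is a factor of `u`. -/
theorem OccursAfter.isInfix {w : ℕ → Letter} {u v : List Letter} {s t : ℕ}
    (hu : OccursAfter w u t) (hv : OccursAfter w v s) (h1 : t ≤ s)
    (h2 : s + v.length ≤ t + u.length) : v <:+: u := by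
  have hsplit : u = u.take (s - t) ++ ((u.drop (s - t)).take v.length ++
      (u.drop (s - t)).drop v.length) := by
    rw [List.take_append_drop, List.take_append_drop]
  rw [hsplit, occursAfter_append, occursAfter_append] at hu
  have h3 : t + (u.take (s - t)).length = s := by
    rw [List.length_take]; omega
  rw [h3] at hu
  have h4 := hu.2.1.eq_of_length hv (by rw [List.length_take, List.length_drop]; omega)
  rw [h4] at hsplit
  exact ⟨_, _, by rw [List.append_assoc]; exact hsplit.symm⟩

/-- A factor of an occurring word occurs. -/
theorem OccursAfter.exists_of_isInfix {w : ℕ → Letter} {u v : List Letter} {t : ℕ}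
    (hu : OccursAfter w u t) (h : v <:+: u) :
    ∃ s, t ≤ s ∧ s + v.length ≤ t + u.length ∧ OccursAfter w v s := by
  obtain ⟨l, r, rfl⟩ := h
  rw [List.append_assoc, occursAfter_append, occursAfter_append] at hu
  exact ⟨_, by omega, by simp; omega, hu.2.1⟩

/-! ### Iterated substitutions -/

/-- The word `σ_d^m(u)`. -/
def subst (d m : ℕ) (u : List Letter) : List Letter :=
  (fun u : List Letter => u.flatMap (sigma d))^[m] u

@[simp] theorem subst_zero (d : ℕ) (u : List Letter) : subst d 0 u = u := rfl

theorem subst_succ (d m : ℕ) (u : List Letter) :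
    subst d (m + 1) u = (subst d m u).flatMap (sigma d) :=
  Function.iterate_succ_apply' _ _ _

theorem subst_succ' (d m : ℕ) (u : List Letter) :
    subst d (m + 1) u = subst d m (u.flatMap (sigma d)) :=
  Function.iterate_succ_apply _ _ _

theorem subst_one (d : ℕ) (u : List Letter) : subst d 1 u = u.flatMap (sigma d) := rfl

@[simp] theorem subst_nil (d m : ℕ) : subst d m [] = [] := by
  induction m with
  | zero => rfl
  | succ m ih => rw [subst_succ, ih]; rfl

theorem subst_append (d m : ℕ) (u v : List Letter) :
    subst d m (u ++ v) = subst d m u ++ subst d m v := by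
  induction m with
  | zero => rfl
  | succ m ih => simp only [subst_succ, ih, List.flatMap_append]

theorem subst_a (d m : ℕ) : subst d m [a] = F d m := rfl

theorem subst_b (d m : ℕ) : subst d m [b] = Fpred d m := by
  cases m with
  | zero => rfl
  | succ m => rw [subst_succ']; rfl

theorem subst_replicate (d m r : ℕ) (u : List Letter) (c : Letter) (h : subst d m [c] = u) :
    subst d m (List.replicate r c) = (List.replicate r u).flatten := by
  induction r with
  | zero => simp
  | succ r ih =>
    rw [List.replicate_succ, ← List.singleton_append, subst_append, ih, h,
      List.replicate_succ, List.flatten_cons]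

theorem F_succ (d m : ℕ) :
    F d (m + 1) = (List.replicate d (F d m)).flatten ++ Fpred d m := by
  rw [← subst_a, subst_succ']
  simp only [List.flatMap_cons, List.flatMap_nil, List.append_nil, sigma]
  rw [subst_append, subst_b, subst_replicate d m d _ a (subst_a d m)]

theorem Fpred_succ (d m : ℕ) : Fpred d (m + 1) = F d m := rfl

theorem Fpred_ne_nil_and (d m : ℕ) : Fpred d m ≠ [] ∧ F d m ≠ [] := by
  induction m with
  | zero => exact ⟨by simp [Fpred], by simp [F]⟩
  | succ m ih => exact ⟨ih.2, by rw [F_succ]; simp [ih.1]⟩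

theorem F_ne_nil (d m : ℕ) : F d m ≠ [] := (Fpred_ne_nil_and d m).2

theorem Fpred_ne_nil (d m : ℕ) : Fpred d m ≠ [] := (Fpred_ne_nil_and d m).1

theorem length_F_pos (d m : ℕ) : 0 < (F d m).length := List.length_pos_iff.2 (F_ne_nil d m)

theorem length_Fpred_pos (d m : ℕ) : 0 < (Fpred d m).length :=
  List.length_pos_iff.2 (Fpred_ne_nil d m)

theorem subst_singleton_length_pos (d m : ℕ) (c : Letter) : 0 < (subst d m [c]).length := by
  cases c
  · exact length_F_pos d m
  · rw [subst_b]; exact length_Fpred_pos d m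

/-! ### Fixed points of `σ_d` -/

/-- The infinite word `w` is fixed by `σ_d`. -/
def IsFixed (d : ℕ) (w : ℕ → Letter) : Prop :=
  ∀ n, OccursAfter w (sigma d (w n)) ((pre w n).flatMap (sigma d)).length

/-- The length of `σ_d^m` of the prefix of length `n`. -/
def pos (d : ℕ) (w : ℕ → Letter) (m n : ℕ) : ℕ := (subst d m (pre w n)).length

@[simp] theorem pos_zero_right (d : ℕ) (w : ℕ → Letter) (m : ℕ) : pos d w m 0 = 0 := by
  simp [pos]

theorem pos_succ_right (d : ℕ) (w : ℕ → Letter) (m n : ℕ) :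
    pos d w m (n + 1) = pos d w m n + (subst d m [w n]).length := by
  simp [pos, pre_succ, subst_append]

@[simp] theorem pos_zero_left (d : ℕ) (w : ℕ → Letter) (n : ℕ) : pos d w 0 n = n := by
  simp [pos]

theorem pos_add {d : ℕ} {w : ℕ → Letter} {v : List Letter} {n : ℕ} (m : ℕ)
    (h : OccursAfter w v n) :
    pos d w m (n + v.length) = pos d w m n + (subst d m v).length := by
  rw [occursAfter_iff_pre] at h
  simp [pos, h, subst_append]

theorem pos_strictMono (d : ℕ) (w : ℕ → Letter) (m : ℕ) : StrictMono (pos d w m) :=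
  strictMono_nat_of_lt_succ fun n => by
    rw [pos_succ_right]
    have := subst_singleton_length_pos d m (w n)
    omega

theorem exists_mem_block {e : ℕ → ℕ} (he : StrictMono e) (h0 : e 0 = 0) (t : ℕ) :
    ∃ s, e s ≤ t ∧ t < e (s + 1) := by
  induction t with
  | zero =>
    have : e 0 < e (0 + 1) := he Nat.zero_lt_one
    exact ⟨0, h0.le, by omega⟩
  | succ t ih =>
    obtain ⟨s, h1, h2⟩ := ih
    rcases Nat.lt_or_ge (t + 1) (e (s + 1)) with h | h
    · exact ⟨s, by omega, h⟩
    · have : e (s + 1) < e (s + 1 + 1) := he (Nat.lt_succ_self _)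
      exact ⟨s + 1, h, by omega⟩

theorem IsFixed.flatMap_pre {d : ℕ} {w : ℕ → Letter} (hw : IsFixed d w) (n : ℕ) :
    (pre w n).flatMap (sigma d) = pre w (pos d w 1 n) := by
  induction n with
  | zero => simp
  | succ n ih =>
    have h := hw n
    rw [ih, length_pre, occursAfter_iff_pre, ← ih] at h
    rw [pos_succ_right, subst_one, pre_succ, List.flatMap_append]
    simpa using h.symm

theorem IsFixed.subst_pre {d : ℕ} {w : ℕ → Letter} (hw : IsFixed d w) (m n : ℕ) :
    subst d m (pre w n) = pre w (pos d w m n) := by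
  induction m with
  | zero => simp
  | succ m ih =>
    rw [subst_succ, ih, hw.flatMap_pre]
    conv_rhs => rw [pos, subst_succ, ih]
    rfl

theorem IsFixed.pos_succ_left {d : ℕ} {w : ℕ → Letter} (hw : IsFixed d w) (m n : ℕ) :
    pos d w (m + 1) n = pos d w 1 (pos d w m n) := by
  rw [pos, subst_succ, hw.subst_pre, hw.flatMap_pre, length_pre]

/-- The image of an occurring word occurs. -/
theorem IsFixed.occursAfter_subst {d : ℕ} {w : ℕ → Letter} (hw : IsFixed d w) (m : ℕ)
    {v : List Letter} {n : ℕ} (h : OccursAfter w v n) :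
    OccursAfter w (subst d m v) (pos d w m n) := by
  rw [occursAfter_iff_pre, ← pos_add m h, ← hw.subst_pre, ← hw.subst_pre, ← subst_append,
    ← occursAfter_iff_pre.1 h]

/-- Here the innermost substitution is split off, so boundaries of order `m + 1` are seen among
those of order `m`; `IsFixed.pos_succ_left` splits off the outermost one. -/
theorem IsFixed.pos_succ_left' {d : ℕ} {w : ℕ → Letter} (hw : IsFixed d w) (m n : ℕ) :
    pos d w (m + 1) n = pos d w m (pos d w 1 n) := by
  rw [pos, subst_succ', hw.flatMap_pre]
  rfl

theorem IsFixed.occursAfter_F {d : ℕ} {w : ℕ → Letter} (hw : IsFixed d w) (m : ℕ) {n : ℕ}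
    (h : w n = a) : OccursAfter w (F d m) (pos d w m n) :=
  hw.occursAfter_subst m (occursAfter_singleton.2 h)

theorem IsFixed.occursAfter_Fpred {d : ℕ} {w : ℕ → Letter} (hw : IsFixed d w) (m : ℕ) {n : ℕ}
    (h : w n = b) : OccursAfter w (Fpred d m) (pos d w m n) := by
  rw [← subst_b]; exact hw.occursAfter_subst m (occursAfter_singleton.2 h)

theorem pos_succ_of_a {d : ℕ} {w : ℕ → Letter} (m : ℕ) {n : ℕ} (h : w n = a) :
    pos d w m (n + 1) = pos d w m n + (F d m).length := by
  rw [pos_succ_right, h, subst_a]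

theorem pos_succ_of_b {d : ℕ} {w : ℕ → Letter} (m : ℕ) {n : ℕ} (h : w n = b) :
    pos d w m (n + 1) = pos d w m n + (Fpred d m).length := by
  rw [pos_succ_right, h, subst_b]

theorem pos_one_of_a {d : ℕ} {w : ℕ → Letter} {n : ℕ} (h : w n = a) :
    pos d w 1 (n + 1) = pos d w 1 n + d + 1 := by
  rw [pos_succ_of_a 1 h, F_succ]; simp [F, Fpred]; omega

theorem pos_one_of_b {d : ℕ} {w : ℕ → Letter} {n : ℕ} (h : w n = b) :
    pos d w 1 (n + 1) = pos d w 1 n + 1 := by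
  rw [pos_succ_of_b 1 h]; simp [Fpred, F]

theorem IsFixed.block_a {d : ℕ} {w : ℕ → Letter} (hw : IsFixed d w) {n : ℕ} (h : w n = a) :
    (∀ k < d, w (pos d w 1 n + k) = a) ∧ w (pos d w 1 n + d) = b := by
  have h1 := hw n
  rw [h] at h1
  simp only [sigma] at h1
  rw [occursAfter_append, occursAfter_replicate] at h1
  simpa [pos, subst_one] using h1

theorem IsFixed.block_b {d : ℕ} {w : ℕ → Letter} (hw : IsFixed d w) {n : ℕ} (h : w n = b) :
    w (pos d w 1 n) = a := by
  have h1 := hw n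
  rw [h] at h1
  simpa [pos, subst_one, sigma] using h1

/-! ### Desubstitution -/

section Fixed

variable {d : ℕ} {w : ℕ → Letter}

theorem Letter.eq_a_or_b (c : Letter) : c = a ∨ c = b := by cases c <;> simp

theorem IsFixed.apply_pos (hd : 1 ≤ d) (hw : IsFixed d w) (n : ℕ) : w (pos d w 1 n) = a := by
  rcases (w n).eq_a_or_b with h | h
  · exact (hw.block_a h).1 0 hd
  · exact hw.block_b h

/-- Each letter `b` is the last letter of some `σ_d(a)`. -/
theorem IsFixed.exists_of_b (hw : IsFixed d w) {t : ℕ} (h : w t = b) :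
    ∃ n, w n = a ∧ t = pos d w 1 n + d ∧ t + 1 = pos d w 1 (n + 1) := by
  obtain ⟨n, h1, h2⟩ := exists_mem_block (pos_strictMono d w 1) (pos_zero_right d w 1) t
  rcases (w n).eq_a_or_b with hn | hn
  · have h3 := pos_one_of_a (d := d) hn
    have h4 := hw.block_a hn
    obtain ⟨k, rfl⟩ := Nat.exists_eq_add_of_le h1
    rcases Nat.lt_or_ge k d with hk | hk
    · have := h4.1 k hk
      rw [h] at this; cases this
    · exact ⟨n, hn, by omega, by omega⟩
  · have h3 := pos_one_of_b (d := d) hn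
    have h4 := hw.block_b hn
    rw [show pos d w 1 n = t by omega, h] at h4
    cases h4

theorem IsFixed.apply_succ_of_b (hd : 1 ≤ d) (hw : IsFixed d w) {t : ℕ} (h : w t = b) :
    w (t + 1) = a := by
  obtain ⟨n, -, -, h3⟩ := hw.exists_of_b h
  rw [h3]; exact hw.apply_pos hd _

/-- The image of `a` begins with `a^d`. The image of `b` is a single `a`, but `b` is always followed
by `a`, whose image supplies the rest. -/
theorem IsFixed.replicate_pos (hd : 1 ≤ d) (hw : IsFixed d w) (n : ℕ) :
    OccursAfter w (List.replicate d a) (pos d w 1 n) := by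
  rw [occursAfter_replicate]
  intro k hk
  rcases (w n).eq_a_or_b with h | h
  · exact (hw.block_a h).1 k hk
  · cases k with
    | zero => exact hw.block_b h
    | succ k =>
      have := (hw.block_a (hw.apply_succ_of_b hd h)).1 k (by omega)
      rw [pos_one_of_b h] at this
      rwa [show pos d w 1 n + (k + 1) = pos d w 1 n + 1 + k by ring]

theorem replicate_prefix_flatMap_append (d : ℕ) (v : List Letter) :
    List.replicate d a <+: v.flatMap (sigma d) ++ List.replicate d a := by
  induction v with
  | nil => simp
  | cons c v ih =>
    cases c with
    | a => simp [sigma, List.append_assoc]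
    | b =>
      obtain ⟨r, hr⟩ := ih
      rw [List.flatMap_cons, List.append_assoc, ← hr, sigma, List.singleton_append,
        ← List.cons_append, ← List.replicate_succ, List.replicate_succ', List.append_assoc]
      exact List.prefix_append _ _

/-- A block followed by `a^d` comes from `b` only when it is followed by `a^{d+1}`. -/
theorem IsFixed.eq_b_of_replicate (hw : IsFixed d w) {n : ℕ}
    (h : w (pos d w 1 n + d) = a) : w n = b := by
  rcases (w n).eq_a_or_b with hn | hn
  · rw [(hw.block_a hn).2] at h; cases h
  · exact hn

/-- Recognizability: from a known block boundary, the letter at distance `d` tells whether the block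
comes from `a` or from `b`. The trailing `a^d` provides this lookahead for the last blocks. -/
theorem IsFixed.desubst (hd : 2 ≤ d) (hw : IsFixed d w) (v : List Letter) (n : ℕ)
    (h : OccursAfter w (v.flatMap (sigma d) ++ List.replicate d a) (pos d w 1 n)) :
    OccursAfter w v n := by
  induction v generalizing n with
  | nil => simp
  | cons c v ih =>
    rw [List.flatMap_cons, List.append_assoc, occursAfter_append] at h
    obtain ⟨h1, h2⟩ := h
    rw [occursAfter_cons]
    cases c with
    | a =>
      have h3 : w n = a := by
        rcases (w n).eq_a_or_b with hn | hn
        · exact hn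
        · have h4 := hw.replicate_pos (by omega) (n + 1)
          rw [occursAfter_replicate] at h4
          have h5 := h4 (d - 1) (by omega)
          rw [pos_one_of_b hn] at h5
          rw [sigma, occursAfter_append, List.length_replicate, occursAfter_singleton] at h1
          rw [show pos d w 1 n + 1 + (d - 1) = pos d w 1 n + d by omega, h1.2] at h5
          cases h5
      refine ⟨h3, ih _ ?_⟩
      rw [pos_one_of_a h3]
      simpa [sigma, add_assoc] using h2
    | b =>
      have h3 : w n = b := by
        apply hw.eq_b_of_replicate
        have h4 := h2.of_prefix (replicate_prefix_flatMap_append d v)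
        rw [occursAfter_replicate] at h4
        have := h4 (d - 1) (by omega)
        simp only [sigma, List.length_singleton] at this
        rwa [show pos d w 1 n + 1 + (d - 1) = pos d w 1 n + d by omega] at this
      refine ⟨h3, ih _ ?_⟩
      rw [pos_one_of_b h3]
      simpa [sigma] using h2

theorem IsFixed.occursAfter_flatMap (hd : 1 ≤ d) (hw : IsFixed d w) {v : List Letter} {n : ℕ}
    (h : OccursAfter w v n) :
    OccursAfter w (v.flatMap (sigma d) ++ List.replicate d a) (pos d w 1 n) := by
  rw [occursAfter_append]
  refine ⟨hw.occursAfter_subst 1 h, ?_⟩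
  rw [← subst_one, ← pos_add 1 h]
  exact hw.replicate_pos hd _

/-- A letter `b` closes an image of `a`, so a word starting with `b` is aligned with the blocks. The
lookahead `a^d` needed by `IsFixed.desubst` is automatic: by `hv` the word also ends in `b`, and a
block boundary follows. -/
theorem IsFixed.occursAfter_b_cons (hd : 2 ≤ d) (hw : IsFixed d w) (v : List Letter)
    (hv : v = [] ∨ ∃ v', v = v' ++ [a]) (t : ℕ) :
    OccursAfter w (b :: v.flatMap (sigma d)) t ↔
      ∃ s, OccursAfter w (a :: v) s ∧ t + 1 = pos d w 1 (s + 1) := by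
  constructor
  · intro h
    have hd' : OccursAfter w (List.replicate d a) (t + 1 + (v.flatMap (sigma d)).length) := by
      have hb : w (t + (v.flatMap (sigma d)).length) = b := by
        rcases hv with rfl | ⟨v', rfl⟩
        · simpa using h
        · have h' := (occursAfter_cons.1 h).2
          simp only [List.flatMap_append, List.flatMap_singleton, sigma] at h'
          rw [← List.append_assoc, occursAfter_append, occursAfter_singleton] at h'
          rw [← h'.2]
          congr 1
          simp [sigma]
          omega
      obtain ⟨n, -, -, hn⟩ := hw.exists_of_b hb
      rw [show t + 1 + (v.flatMap (sigma d)).length = t + (v.flatMap (sigma d)).length + 1 by omega,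
        hn]
      exact hw.replicate_pos (by omega) _
    rw [occursAfter_cons] at h
    obtain ⟨n, h1, h2, h3⟩ := hw.exists_of_b h.1
    refine ⟨n, occursAfter_cons.2 ⟨h1, hw.desubst hd v _ ?_⟩, h3⟩
    rw [← h3, occursAfter_append]
    exact ⟨h.2, hd'⟩
  · rintro ⟨s, h1, h2⟩
    rw [occursAfter_cons] at h1 ⊢
    have h3 := (hw.block_a h1.1).2
    have h4 := pos_one_of_a (d := d) h1.1
    refine ⟨by rw [show t = pos d w 1 s + d by omega]; exact h3, ?_⟩
    rw [h2]
    exact (occursAfter_append.1 (hw.occursAfter_flatMap (by omega) h1.2)).1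

/-- The word begins with `a^{d+1}`, which cannot start inside an image `a^d b`; its first letter is
therefore the whole image of a `b`. -/
theorem IsFixed.occursAfter_a_cons (hd : 2 ≤ d) (hw : IsFixed d w) (v : List Letter) (t : ℕ) :
    OccursAfter w (a :: (v.flatMap (sigma d) ++ List.replicate d a)) t ↔
      ∃ s, OccursAfter w (b :: v) s ∧ t + 1 = pos d w 1 (s + 1) := by
  constructor
  · intro h
    rw [occursAfter_cons] at h
    have h1 := h.2.of_prefix (replicate_prefix_flatMap_append d v)
    rw [occursAfter_replicate] at h1
    obtain ⟨s, hs1, hs2⟩ := exists_mem_block (pos_strictMono d w 1) (pos_zero_right d w 1) t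
    rcases (w s).eq_a_or_b with hs | hs
    · exfalso
      have h3 := pos_one_of_a (d := d) hs
      have h4 := (hw.block_a hs).2
      rcases Nat.lt_or_ge t (pos d w 1 s + d) with hk | hk
      · have := h1 (pos d w 1 s + d - t - 1) (by omega)
        rw [show t + 1 + (pos d w 1 s + d - t - 1) = pos d w 1 s + d by omega, h4] at this
        cases this
      · rw [show pos d w 1 s + d = t by omega, h.1] at h4; cases h4
    · have h3 := pos_one_of_b (d := d) hs
      refine ⟨s, occursAfter_cons.2 ⟨hs, hw.desubst hd v _ ?_⟩, by omega⟩
      rw [h3, show pos d w 1 s = t by omega]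
      exact h.2
  · rintro ⟨s, h1, h2⟩
    rw [occursAfter_cons] at h1 ⊢
    have h4 := pos_one_of_b (d := d) h1.1
    refine ⟨by rw [show t = pos d w 1 s by omega]; exact hw.block_b h1.1, ?_⟩
    rw [h2]
    exact hw.occursAfter_flatMap (by omega) h1.2

end Fixed

/-! ### Kernel words -/

theorem F_eq_dropLast (d m : ℕ) : F d m = (F d m).dropLast ++ [delta d m] := by
  rw [delta, List.getLastD_eq_getLast?, List.getLast?_eq_getLast_of_ne_nil (F_ne_nil d m)]
  exact (List.dropLast_append_getLast _).symm

theorem delta_succ (d m : ℕ) : delta d (m + 1) = (Fpred d m).getLastD a := by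
  rw [delta, F_succ, List.getLastD_eq_getLast?, List.getLastD_eq_getLast?,
    List.getLast?_append_of_ne_nil _ (Fpred_ne_nil d m)]

theorem Fpred_eq_dropLast (d m : ℕ) :
    Fpred d m = (Fpred d m).dropLast ++ [delta d (m + 1)] := by
  rw [delta_succ, List.getLastD_eq_getLast?,
    List.getLast?_eq_getLast_of_ne_nil (Fpred_ne_nil d m)]
  exact (List.dropLast_append_getLast _).symm

theorem delta_add_two (d m : ℕ) : delta d (m + 2) = delta d m := by
  rw [delta_succ, Fpred_succ, delta]

theorem delta_cases (d m : ℕ) :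
    delta d m = a ∧ delta d (m + 1) = b ∨ delta d m = b ∧ delta d (m + 1) = a := by
  induction m with
  | zero => left; rw [delta_succ]; exact ⟨rfl, rfl⟩
  | succ m ih =>
    rw [show m + 1 + 1 = m + 2 by rfl, delta_add_two]
    tauto

theorem flatMap_Fpred (d m : ℕ) : (Fpred d m).flatMap (sigma d) = F d m := by
  rw [← subst_b, ← subst_succ, subst_b, Fpred_succ]

/-- The kernel word without its first letter. -/
def Ktail (d m i : ℕ) : List Letter :=
  (List.replicate i (F d m)).flatten ++ (Fpred d m).dropLast

theorem K_eq_cons (d m i : ℕ) : K d m i = delta d m :: Ktail d m i := rfl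

theorem flatten_replicate_F (d m i : ℕ) :
    (List.replicate i (F d m)).flatten = subst d m (List.replicate i a) :=
  (subst_replicate d m i _ a (subst_a d m)).symm

/-- `F_{d,m}` is the image of `F_{d,m-1}`, whose last letter is `δ_{m+1}`. If that letter is `b`,
its image is the single letter that `dropLast` removes; if it is `a`, as in `Ktail_succ_of_b`, the
removal leaves `a^d`. These are the word shapes of `IsFixed.occursAfter_b_cons` and
`IsFixed.occursAfter_a_cons`. -/
theorem Ktail_succ_of_a {d m : ℕ} (i : ℕ) (h : delta d m = a) :
    Ktail d (m + 1) i = (Ktail d m i).flatMap (sigma d) := by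
  have h1 : delta d (m + 1) = b := by rcases delta_cases d m with h' | h' <;> simp_all
  have h2 : F d m = (Fpred d m).dropLast.flatMap (sigma d) ++ [a] := by
    conv_lhs => rw [← flatMap_Fpred, Fpred_eq_dropLast d m, h1]
    simp [sigma]
  rw [Ktail, Ktail, flatten_replicate_F, flatten_replicate_F, subst_succ, List.flatMap_append,
    Fpred_succ, h2, List.dropLast_concat]

theorem Ktail_succ_of_b {d m : ℕ} (i : ℕ) (h : delta d m = b) :
    Ktail d (m + 1) i = (Ktail d m i).flatMap (sigma d) ++ List.replicate d a := by
  have h1 : delta d (m + 1) = a := by rcases delta_cases d m with h' | h' <;> simp_all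
  have h2 : F d m =
      ((Fpred d m).dropLast.flatMap (sigma d) ++ List.replicate d a) ++ [b] := by
    conv_lhs => rw [← flatMap_Fpred, Fpred_eq_dropLast d m, h1]
    simp [sigma]
  rw [Ktail, Ktail, flatten_replicate_F, flatten_replicate_F, subst_succ, List.flatMap_append,
    Fpred_succ, h2, List.dropLast_concat, List.append_assoc]

theorem Ktail_end {d m : ℕ} (hd : 1 ≤ d) (i : ℕ) (h : delta d m = a) :
    Ktail d m i = [] ∨ ∃ v', Ktail d m i = v' ++ [a] := by
  cases m with
  | zero =>
    cases i with
    | zero => left; simp [Ktail, Fpred]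
    | succ i =>
      right
      refine ⟨List.replicate i a, ?_⟩
      rw [Ktail, flatten_replicate_F, subst_zero, List.replicate_succ']
      simp [Fpred]
  | succ m =>
    right
    have h1 : delta d m = b := by rcases delta_cases d m with h' | h' <;> simp_all
    obtain ⟨k, rfl⟩ := Nat.exists_eq_add_of_le' hd
    rw [Ktail_succ_of_b i h1, List.replicate_succ', ← List.append_assoc]
    exact ⟨_, rfl⟩

/-- The kernel word `K_{d,m,i}` occurs exactly at the last letters of the blocks `F_{d,m}` that
start `i + 1` consecutive such blocks. -/
theorem IsFixed.occursAfter_K {d : ℕ} {w : ℕ → Letter} (hd : 2 ≤ d) (hw : IsFixed d w)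
    (m i s : ℕ) : OccursAfter w (K d m i) s ↔
      ∃ n, OccursAfter w (List.replicate (i + 1) a) n ∧ s + 1 = pos d w m (n + 1) := by
  induction m generalizing s with
  | zero =>
    have : K d 0 i = List.replicate (i + 1) a := by
      rw [K_eq_cons, Ktail, flatten_replicate_F]
      simp [Fpred, delta, F, List.replicate_succ]
    simp [this]
  | succ m ih =>
    have key : OccursAfter w (K d (m + 1) i) s ↔
        ∃ t, OccursAfter w (K d m i) t ∧ s + 1 = pos d w 1 (t + 1) := by
      rcases delta_cases d m with h | h
      · rw [K_eq_cons, K_eq_cons, h.1, h.2, Ktail_succ_of_a i h.1]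
        exact hw.occursAfter_b_cons hd _ (Ktail_end (by omega) i h.1) s
      · rw [K_eq_cons, K_eq_cons, h.1, h.2, Ktail_succ_of_b i h.1]
        exact hw.occursAfter_a_cons hd _ s
    rw [key]
    constructor
    · rintro ⟨t, h1, h2⟩
      obtain ⟨n, h3, h4⟩ := (ih t).1 h1
      exact ⟨n, h3, by rw [h2, h4, hw.pos_succ_left m]⟩
    · rintro ⟨n, h1, h2⟩
      have h3 : 0 < pos d w m (n + 1) := by
        have := pos_strictMono d w m (Nat.succ_pos n)
        simpa using this
      refine ⟨pos d w m (n + 1) - 1, (ih _).2 ⟨n, h1, by omega⟩, ?_⟩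
      rw [h2, hw.pos_succ_left m, Nat.sub_add_cancel h3]

/-- `F_{d,m} F_{d,m-1}` and `F_{d,m-1} F_{d,m}` differ by the order of their last two letters. -/
theorem exists_near_comm (d m : ℕ) : ∃ P : List Letter,
    F d m ++ Fpred d m = P ++ [delta d m, delta d (m + 1)] ∧
      Fpred d m ++ F d m = P ++ [delta d (m + 1), delta d m] := by
  induction m with
  | zero => exact ⟨[], by rw [delta_succ]; rfl, by rw [delta_succ]; rfl⟩
  | succ m ih =>
    obtain ⟨P, h1, h2⟩ := ih
    refine ⟨(List.replicate d (F d m)).flatten ++ P, ?_, ?_⟩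
    · rw [F_succ, Fpred_succ, List.append_assoc, h2, List.append_assoc,
        show m + 1 + 1 = m + 2 by rfl, delta_add_two]
    · rw [Fpred_succ, F_succ, ← List.append_assoc, ← List.flatten_cons, ← List.replicate_succ,
        List.replicate_succ', List.flatten_concat, List.append_assoc, h1, List.append_assoc,
        show m + 1 + 1 = m + 2 by rfl, delta_add_two]

/-- The exponent `d` is not allowed as a type; this identifies the word that follows `K_{d,m,d-1}`
as a kernel of higher order. -/
theorem K_add_two_zero (d m : ℕ) : K d (m + 2) 0 = K d m d := by
  rw [K_eq_cons, K_eq_cons, delta_add_two, Ktail, Ktail, Fpred_succ, F_succ d m,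
    List.dropLast_append_of_ne_nil (Fpred_ne_nil d m)]
  simp

/-! ### The cutting sequence is fixed by `σ_d` -/

theorem slope_sq_add (d : ℕ) : slope d ^ 2 + d * slope d = 1 := by
  have h := slope_eq d
  have hp := slope_pos d
  have hd : (0 : ℝ) < (d : ℝ) + slope d := by positivity
  rw [eq_div_iff hd.ne'] at h
  linarith

theorem slope_lt_one {d : ℕ} (hd : 1 ≤ d) : slope d < 1 := by
  have h := slope_sq_add d
  have hp := slope_pos d
  have hd' : (1 : ℝ) ≤ d := by exact_mod_cast hd
  nlinarith

theorem irrational_slope {d : ℕ} (hd : 1 ≤ d) : Irrational (slope d) := by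
  have h : ¬ IsSquare (d ^ 2 + 4) := by
    rintro ⟨r, hr⟩
    -- The only square strictly between `d²` and `(d + 2)²` is `(d + 1)²`, and `d² + 4 = (d + 1)²`
    -- fails by parity.
    have h1 : d < r := by nlinarith
    have h2 : r < d + 2 := by nlinarith
    obtain rfl : r = d + 1 := by omega
    ring_nf at hr
    omega
  have h1 : Irrational (Real.sqrt ((d ^ 2 + 4 : ℕ) : ℝ)) := irrational_sqrt_natCast_iff.2 h
  have h2 := (h1.sub_natCast d).div_natCast (m := 2) two_ne_zero
  simpa [slope] using h2

theorem Irrational.natCast_mul_ne {θ : ℝ} (h : Irrational θ) {k : ℕ} (hk : k ≠ 0) (l : ℕ) :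
    (k : ℝ) * θ ≠ l :=
  (h.natCast_mul hk).ne_nat l

/-- There are `k` vertical crossings and `⌊kθ⌋` horizontal ones; irrationality of `θ` makes the two
families disjoint. -/
theorem ncard_crossings {θ : ℝ} (hθ : 0 < θ) (hirr : Irrational θ) (k : ℕ) :
    (crossings θ ∩ Set.Iic (k : ℝ)).ncard = k + ⌊(k : ℝ) * θ⌋₊ := by
  have h : crossings θ ∩ Set.Iic (k : ℝ) =
      (fun j : ℕ => (j : ℝ)) '' Set.Icc 1 k ∪
        (fun l : ℕ => (l : ℝ) / θ) '' Set.Icc 1 ⌊(k : ℝ) * θ⌋₊ := by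
    ext x
    simp only [crossings, Set.mem_inter_iff, Set.mem_ofPred_eq, Set.mem_Iic, Set.mem_union,
      Set.mem_image, Set.mem_Icc]
    constructor
    · rintro ⟨⟨hx, ⟨j, rfl⟩ | ⟨l, hl⟩⟩, hk⟩
      · left
        have hj : 0 < j := by exact_mod_cast hx
        lift j to ℕ using hj.le
        refine ⟨j, ⟨by omega, by exact_mod_cast hk⟩, by simp⟩
      · right
        have hl0 : 0 < l := by
          have : 0 < θ * x := by positivity
          rw [hl] at this
          exact_mod_cast this
        lift l to ℕ using hl0.le
        rw [Int.cast_natCast] at hl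
        refine ⟨l, ⟨by omega, Nat.le_floor ?_⟩, by rw [← hl]; field_simp⟩
        rw [← hl]; nlinarith
    · rintro (⟨j, ⟨h1, h2⟩, rfl⟩ | ⟨l, ⟨h1, h2⟩, rfl⟩)
      · exact ⟨⟨by exact_mod_cast h1, Or.inl ⟨j, by simp⟩⟩, by exact_mod_cast h2⟩
      · have hl : (0 : ℝ) < l := by exact_mod_cast h1
        refine ⟨⟨by positivity, Or.inr ⟨l, by field_simp; simp⟩⟩, ?_⟩
        rw [div_le_iff₀ hθ]
        exact (Nat.le_floor_iff (by positivity)).1 h2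
  rw [h, Set.ncard_union_eq, Set.ncard_image_of_injective _ Nat.cast_injective,
    Set.ncard_image_of_injective]
  · simp [Set.ncard_eq_toFinset_card']
  · intro x y hxy
    simp only [div_left_inj' hθ.ne'] at hxy
    exact_mod_cast hxy
  · rw [Set.disjoint_left]
    rintro _ ⟨j, ⟨h1, -⟩, rfl⟩ ⟨l, -, hl⟩
    exact Irrational.natCast_mul_ne hirr (by omega : j ≠ 0) l ((div_eq_iff hθ.ne').1 hl).symm

/-- The first `n` crossings are with `A` vertical and `B` horizontal lines. -/
def Counts (θ : ℝ) (n A B : ℕ) : Prop :=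
  A + B = n ∧ (A : ℝ) * θ < B + 1 ∧ (B : ℝ) < (A + 1) * θ

section Cutting

variable {θ : ℝ} {n A B : ℕ}

/-- The crossing with `x = A + 1` comes before the one with `y = B + 1`, so exactly `A + 1 + B`
crossings lie up to it. -/
theorem Counts.cuttingSeq_eq_a (hθ : 0 < θ) (hirr : Irrational θ) (h : Counts θ n A B)
    (hlt : ((A : ℝ) + 1) * θ < B + 1) : cuttingSeq θ n = a := by
  obtain ⟨h1, h2, h3⟩ := h
  rw [cuttingSeq, if_pos]
  refine ⟨((A + 1 : ℕ) : ℝ), ⟨by positivity, Or.inl ⟨(A + 1 : ℕ), by simp⟩⟩, ?_,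
    ⟨(A + 1 : ℕ), by simp⟩⟩
  have hf : ⌊((A + 1 : ℕ) : ℝ) * θ⌋₊ = B :=
    (Nat.floor_eq_iff (by positivity)).2 (by push_cast; exact ⟨h3.le, hlt⟩)
  rw [ncard_crossings hθ hirr, hf]
  omega

theorem Counts.cuttingSeq_eq_b (hθ : 0 < θ) (hirr : Irrational θ) (h : Counts θ n A B)
    (hlt : (B : ℝ) + 1 < (A + 1) * θ) : cuttingSeq θ n = b := by
  obtain ⟨h1, h2, h3⟩ := h
  rw [cuttingSeq, if_neg]
  rintro ⟨x, ⟨hx, -⟩, h4, ⟨k, rfl⟩⟩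
  have hk : 0 < k := by exact_mod_cast hx
  lift k to ℕ using hk.le
  rw [Int.cast_natCast, ncard_crossings hθ hirr] at h4
  -- No vertical line has rank `n + 1`: up to `x = k` there are too many crossings if `k > A` and
  -- too few if `k ≤ A`.
  rcases Nat.lt_or_ge A k with hAk | hAk
  · have : B + 1 ≤ ⌊(k : ℝ) * θ⌋₊ := by
      apply Nat.le_floor
      push_cast
      have : (A : ℝ) + 1 ≤ k := by exact_mod_cast hAk
      nlinarith
    omega
  · have : ⌊(k : ℝ) * θ⌋₊ < B + 1 := by
      rw [Nat.floor_lt (by positivity)]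
      push_cast
      have : (k : ℝ) ≤ A := by exact_mod_cast hAk
      nlinarith
    omega

theorem Counts.cases (hirr : Irrational θ) (A B : ℕ) :
    ((A : ℝ) + 1) * θ < B + 1 ∨ (B : ℝ) + 1 < (A + 1) * θ := by
  apply lt_or_gt_of_ne
  have := Irrational.natCast_mul_ne hirr (Nat.succ_ne_zero A) (B + 1)
  push_cast at this
  exact this

theorem Counts.succ_a (h : Counts θ n A B) (hθ : 0 < θ)
    (hlt : ((A : ℝ) + 1) * θ < B + 1) : Counts θ (n + 1) (A + 1) B := by
  obtain ⟨h1, h2, h3⟩ := h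
  refine ⟨by omega, by push_cast; exact hlt, by push_cast; nlinarith⟩

theorem Counts.succ_b (h : Counts θ n A B)
    (hlt : (B : ℝ) + 1 < (A + 1) * θ) : Counts θ (n + 1) A (B + 1) := by
  obtain ⟨h1, h2, h3⟩ := h
  refine ⟨by omega, by push_cast; linarith, by push_cast; exact hlt⟩

end Cutting

theorem exists_counts {d : ℕ} (hd : 1 ≤ d) (n : ℕ) : ∃ A B, Counts (slope d) n A B ∧
    pos d (Finf d) 1 n = n + d * A := by
  have hp := slope_pos d
  have hirr := irrational_slope hd
  induction n with
  | zero => exact ⟨0, 0, ⟨rfl, by simp, by simpa using hp⟩, by simp⟩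
  | succ n ih =>
    obtain ⟨A, B, h, hpos⟩ := ih
    rcases Counts.cases hirr A B with hlt | hlt
    · refine ⟨A + 1, B, h.succ_a hp hlt, ?_⟩
      rw [pos_one_of_a (w := Finf d) (h.cuttingSeq_eq_a hp hirr hlt), hpos]
      ring
    · refine ⟨A, B + 1, h.succ_b hlt, ?_⟩
      rw [pos_one_of_b (w := Finf d) (h.cuttingSeq_eq_b hp hirr hlt), hpos]
      ring

/-- The image of a word with `A` letters `a` and `B` letters `b` has `dA + B` and `A` of them. By
`θ² + dθ = 1`, `(dA + B)θ - A = θ(B - Aθ)`, so the new inequalities follow from the old ones. -/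
theorem Counts.image {d n A B : ℕ} (hd : 1 ≤ d) (h : Counts (slope d) n A B) :
    Counts (slope d) (n + d * A) (d * A + B) A := by
  obtain ⟨h1, h2, h3⟩ := h
  have hp := slope_pos d
  have hq := slope_sq_add d
  have hl := slope_lt_one hd
  refine ⟨by omega, ?_, ?_⟩
  · push_cast
    have : (d * A + B : ℝ) * slope d = A * (1 - slope d ^ 2) + B * slope d := by
      rw [← hq]; ring
    nlinarith
  · push_cast
    have : (d * A + B + 1 : ℝ) * slope d = A * (1 - slope d ^ 2) + (B + 1) * slope d := by
      rw [← hq]; ring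
    nlinarith

theorem Counts.run {d n A B : ℕ} (hd : 1 ≤ d) (h : Counts (slope d) n A B) (j : ℕ)
    (hj : ((A : ℝ) + j) * slope d < B + 1) :
    Counts (slope d) (n + j) (A + j) B ∧ ∀ k < j, Finf d (n + k) = a := by
  have hp := slope_pos d
  induction j with
  | zero => exact ⟨h, by simp⟩
  | succ j ih =>
    push_cast at hj
    obtain ⟨h1, h2⟩ := ih (by nlinarith)
    have hlt : (((A + j : ℕ) : ℝ) + 1) * slope d < B + 1 := by push_cast; nlinarith
    refine ⟨h1.succ_a hp hlt, fun k hk => ?_⟩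
    rcases Nat.lt_succ_iff_lt_or_eq.1 hk with hk | rfl
    · exact h2 k hk
    · exact h1.cuttingSeq_eq_a hp (irrational_slope hd) hlt

/-- Letter by letter, the state `(A, B)` after `n` crossings is compared with the image state `(dA +
B, A)`: the next letter at the first state decides whether `a^d b` or `a` is read from the second.
-/
theorem isFixed_Finf {d : ℕ} (hd : 1 ≤ d) : IsFixed d (Finf d) := by
  intro n
  have hp := slope_pos d
  have hq := slope_sq_add d
  have hl := slope_lt_one hd
  have hirr := irrational_slope hd
  obtain ⟨A, B, h, hpos⟩ := exists_counts hd n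
  rw [pos, subst_one] at hpos
  rw [hpos]
  have hi := h.image hd
  rcases Counts.cases hirr A B with hlt | hlt
  · rw [show Finf d n = a from h.cuttingSeq_eq_a hp hirr hlt, sigma, occursAfter_append,
      occursAfter_replicate, List.length_replicate, occursAfter_singleton]
    -- Written this way, fitting `d` vertical lines before the next horizontal one amounts to `B <
    -- (A + 1)θ`, and having a horizontal line next amounts to `(A + 1)θ < B + 1`.
    have e1 : ((d * A + B : ℕ) + (d : ℕ) : ℝ) * slope d =
        (A + 1) * (1 - slope d ^ 2) + B * slope d := by
      push_cast
      linear_combination ((A : ℝ) + 1) * hq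
    obtain ⟨h1, h2⟩ := hi.run hd d (by rw [e1]; nlinarith [h.2.2])
    refine ⟨h2, h1.cuttingSeq_eq_b hp hirr ?_⟩
    push_cast at e1 ⊢
    nlinarith
  · rw [show Finf d n = b from h.cuttingSeq_eq_b hp hirr hlt, sigma, occursAfter_singleton]
    have e1 : ((d * A + B : ℕ) + 1 : ℝ) * slope d =
        A * (1 - slope d ^ 2) + (B + 1) * slope d := by
      rw [← hq]; push_cast; ring
    apply hi.cuttingSeq_eq_a hp hirr
    rw [e1]
    have := mul_lt_mul_of_pos_right
      (show (B : ℝ) + 1 - A * slope d < slope d by linarith) hp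
    nlinarith

/-! ### The sequence of gaps between the occurrences of a run of letters `a` -/

theorem pre_prefix_pre (w : ℕ → Letter) {n n' : ℕ} (h : n ≤ n') : pre w n <+: pre w n' := by
  obtain ⟨k, rfl⟩ := Nat.exists_eq_add_of_le h
  rw [pre, pre, List.range_add, List.map_append]
  exact List.prefix_append _ _

theorem prefix_flatMap {u v : List Letter} (h : u <+: v) (g : Letter → List Letter) :
    u.flatMap g <+: v.flatMap g := by
  obtain ⟨r, rfl⟩ := h
  rw [List.flatMap_append]
  exact List.prefix_append _ _

theorem eq_pre_of_prefix {w : ℕ → Letter} {u : List Letter} {n : ℕ} (h : u <+: pre w n) :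
    u = pre w u.length := by
  have h1 : u.length ≤ n := by simpa using h.length_le
  exact (List.prefix_of_prefix_length_le h (pre_prefix_pre w h1) (by simp)).eq_of_length (by simp)

theorem length_le_flatMap_sigma (k : ℕ) (u : List Letter) :
    u.length ≤ (u.flatMap (sigma k)).length := by
  induction u with
  | nil => simp
  | cons c u ih =>
    rw [List.flatMap_cons, List.length_append, List.length_cons]
    have : 1 ≤ (sigma k c).length := by cases c <;> simp [sigma]
    omega

/-- Images of longer prefixes extend those of shorter ones, so the truncation in `sigmaInf` does not
affect any letter. -/
theorem pre_sigmaInf (k : ℕ) (w : ℕ → Letter) (n : ℕ) :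
    pre (sigmaInf k w) ((pre w n).flatMap (sigma k)).length = (pre w n).flatMap (sigma k) := by
  apply List.ext_getElem (by simp)
  intro j h1 h2
  have h3 : j < ((pre w (j + 1)).flatMap (sigma k)).length := by
    have := length_le_flatMap_sigma k (pre w (j + 1))
    simp only [length_pre] at this
    omega
  have h4 : (pre (sigmaInf k w) ((pre w n).flatMap (sigma k)).length)[j] =
      ((pre w (j + 1)).flatMap (sigma k))[j] := by
    simp only [pre, List.getElem_map, List.getElem_range, sigmaInf]
    exact List.getD_eq_getElem _ _ h3
  rw [h4]
  rcases le_total n (j + 1) with h | h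
  · exact ((prefix_flatMap (pre_prefix_pre w h) (sigma k)).getElem h2).symm
  · exact (prefix_flatMap (pre_prefix_pre w h) (sigma k)).getElem h3

/-- The substitution `a ↦ a`, `b ↦ a^{i+1} b`. -/
def tau (i : ℕ) : Letter → List Letter
  | a => [a]
  | b => List.replicate (i + 1) a ++ [b]

/-- Source of the sets `Γ_{i,γ}`: with `k = d - i - 1`, the fixed point of `σ_d` is the `tau
i`-image of `σ_{d-i-1}` of itself. -/
theorem flatMap_sigma_tau (k i : ℕ) (u : List Letter) :
    (u.flatMap (sigma k)).flatMap (tau i) = u.flatMap (sigma (k + i + 1)) := by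
  induction u with
  | nil => rfl
  | cons c u ih =>
    rw [List.flatMap_cons, List.flatMap_append, ih, List.flatMap_cons]
    congr 1
    cases c with
    | a =>
      have h : ∀ k : ℕ, (List.replicate k a).flatMap (tau i) = List.replicate k a := by
        intro k
        induction k with
        | zero => rfl
        | succ k ih => rw [List.replicate_succ, List.flatMap_cons, ih]; rfl
      rw [sigma, List.flatMap_append, h, List.flatMap_singleton, tau, sigma, ← List.append_assoc,
        ← List.replicate_add, add_assoc]
    | b => rfl

/-- The length of the image under `tau i` of the prefix of length `p` of `σ_{d-i-1}(w)`. -/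
def runPos (d : ℕ) (w : ℕ → Letter) (i p : ℕ) : ℕ :=
  ((pre (sigmaInf (d - i - 1) w) p).flatMap (tau i)).length

section Runs

variable {d : ℕ} {w : ℕ → Letter} {i : ℕ}

theorem IsFixed.pre_runPos (hw : IsFixed d w) (hi : i < d) (p : ℕ) :
    (pre (sigmaInf (d - i - 1) w) p).flatMap (tau i) = pre w (runPos d w i p) := by
  -- The prefix of length `p` of the coding sequence is contained in the `σ_{d-i-1}`-image of the
  -- prefix of length `p` of `w`, whose `tau i`-image is a prefix of `w`.
  refine eq_pre_of_prefix (n := pos d w 1 p) ?_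
  rw [← hw.flatMap_pre, ← show d - i - 1 + i + 1 = d by omega, ← flatMap_sigma_tau]
  apply prefix_flatMap
  rw [← pre_sigmaInf, show d - i - 1 + i + 1 - i - 1 = d - i - 1 by omega]
  apply pre_prefix_pre
  simpa using length_le_flatMap_sigma (d - i - 1) (pre w p)

@[simp] theorem runPos_zero (d : ℕ) (w : ℕ → Letter) (i : ℕ) : runPos d w i 0 = 0 := by
  simp [runPos]

theorem runPos_succ (d : ℕ) (w : ℕ → Letter) (i p : ℕ) : runPos d w i (p + 1) =
    runPos d w i p + (tau i (sigmaInf (d - i - 1) w p)).length := by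
  simp [runPos, pre_succ]

theorem runPos_strictMono (d : ℕ) (w : ℕ → Letter) (i : ℕ) : StrictMono (runPos d w i) :=
  strictMono_nat_of_lt_succ fun p => by
    rw [runPos_succ]
    cases sigmaInf (d - i - 1) w p <;> simp [tau]

theorem IsFixed.occursAfter_tau (hw : IsFixed d w) (hi : i < d) (p : ℕ) :
    OccursAfter w (tau i (sigmaInf (d - i - 1) w p)) (runPos d w i p) := by
  rw [occursAfter_iff_pre, ← runPos_succ, ← hw.pre_runPos hi, ← hw.pre_runPos hi, pre_succ,
    List.flatMap_append, List.flatMap_singleton]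

theorem IsFixed.replicate_runPos (hw : IsFixed d w) (hi : i < d) (j p : ℕ) (hj : j ≤ i + 1) :
    OccursAfter w (List.replicate j a) (runPos d w i p) := by
  induction j generalizing p with
  | zero => simp
  | succ j ih =>
    have h := hw.occursAfter_tau hi p
    have hs := runPos_succ d w i p
    rcases (sigmaInf (d - i - 1) w p).eq_a_or_b with hz | hz
    · rw [hz, tau, occursAfter_singleton] at h
      rw [hz, tau, List.length_singleton] at hs
      rw [List.replicate_succ, occursAfter_cons, ← hs]
      exact ⟨h, ih _ (by omega)⟩
    · rw [hz, tau, occursAfter_append, occursAfter_replicate] at h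
      rw [occursAfter_replicate]
      exact fun k hk => h.1 k (by omega)

/-- The positions `runPos d w i p` are those at which `a^{i+1}` occurs. -/
theorem IsFixed.occursAfter_replicate_iff (hw : IsFixed d w) (hi : i < d) (n : ℕ) :
    OccursAfter w (List.replicate (i + 1) a) n ↔ ∃ p, n = runPos d w i p := by
  constructor
  · intro h
    obtain ⟨p, h1, h2⟩ := exists_mem_block (runPos_strictMono d w i) (runPos_zero d w i) n
    refine ⟨p, ?_⟩
    have ht := hw.occursAfter_tau hi p
    rw [runPos_succ] at h2
    rcases (sigmaInf (d - i - 1) w p).eq_a_or_b with hz | hz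
    · rw [hz, tau, List.length_singleton] at h2
      omega
    · rw [hz, tau, occursAfter_append, List.length_replicate, occursAfter_singleton] at ht
      rw [hz, tau, List.length_append, List.length_replicate, List.length_singleton] at h2
      by_contra hne
      rw [occursAfter_replicate] at h
      -- The `b` closing `tau i b` would fall within a run `a^{i+1}` that started strictly inside
      -- this block.
      have h3 := h (runPos d w i p + (i + 1) - n) (by omega)
      rw [show n + (runPos d w i p + (i + 1) - n) = runPos d w i p + (i + 1) by omega, ht.2] at h3
      cases h3
  · rintro ⟨p, rfl⟩
    exact hw.replicate_runPos hi _ _ le_rfl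

end Runs

/-- The distance between two consecutive occurrences of `K_{d,m,i}`, for each of the two letters
of the coding sequence `σ_{d-i-1}(F_{d,∞})`. -/
def ret (d m i : ℕ) : Letter → ℕ
  | a => (F d m).length
  | b => (i + 1) * (F d m).length + (Fpred d m).length

theorem length_subst_tau (d m i : ℕ) (c : Letter) :
    (subst d m (tau i c)).length = ret d m i c := by
  cases c with
  | a => rfl
  | b => simp [tau, ret, subst_append, ← flatten_replicate_F, subst_b]

theorem IsFixed.pos_runPos_succ {d : ℕ} {w : ℕ → Letter} {i : ℕ} (hw : IsFixed d w) (hi : i < d)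
    (m p : ℕ) : pos d w m (runPos d w i (p + 1)) =
      pos d w m (runPos d w i p) + ret d m i (sigmaInf (d - i - 1) w p) := by
  rw [runPos_succ, pos_add m (hw.occursAfter_tau hi p), length_subst_tau]

/-- The letters between two consecutive occurrences of a kernel word, and the block after. -/
theorem IsFixed.occursAfter_return {d : ℕ} {w : ℕ → Letter} {i : ℕ} (hw : IsFixed d w)
    (hi : i < d) (m p : ℕ) :
    OccursAfter w (subst d m (tau i (sigmaInf (d - i - 1) w p)) ++ F d m)
      (pos d w m (runPos d w i p)) := by
  rw [occursAfter_append, length_subst_tau, ← hw.pos_runPos_succ hi]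
  refine ⟨hw.occursAfter_subst m (hw.occursAfter_tau hi p), hw.occursAfter_F m ?_⟩
  simpa using hw.replicate_runPos hi 1 (p + 1) (by omega)

/-! ### Occurrences of the words with an expression -/

theorem length_F (d m : ℕ) : (F d m).length = f d m := rfl

theorem length_Fpred {m : ℕ} (d : ℕ) (hm : 1 ≤ m) : (Fpred d m).length = f d (m - 1) := by
  obtain ⟨k, rfl⟩ := Nat.exists_eq_add_of_le' hm
  rfl

theorem length_K (d m i : ℕ) :
    (K d m i).length = i * (F d m).length + (Fpred d m).length := by
  have := length_Fpred_pos d m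
  simp [K]
  omega

theorem Fpred_prefix_F (d m : ℕ) (hd : 1 ≤ d) (hm : 1 ≤ m) : Fpred d m <+: F d m := by
  obtain ⟨k, rfl⟩ := Nat.exists_eq_add_of_le' hm
  obtain ⟨j, rfl⟩ := Nat.exists_eq_add_of_le' hd
  rw [F_succ, Fpred_succ, List.replicate_succ, List.flatten_cons, List.append_assoc]
  exact List.prefix_append _ _

theorem OccursAfter.drop {w : ℕ → Letter} {u : List Letter} {s k : ℕ}
    (h : OccursAfter w u s) (hk : k ≤ u.length) : OccursAfter w (u.drop k) (s + k) := by
  rw [← List.take_append_drop k u, occursAfter_append] at h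
  simpa [hk] using h.2

section Fixed

variable {d : ℕ} {w : ℕ → Letter} {m i n : ℕ}

/-- After `a^{i+1}`, the letters that follow the kernel word are determined. -/
theorem IsFixed.occursAfter_right (hd : 2 ≤ d) (hw : IsFixed d w)
    (hm : 1 ≤ m) (h : OccursAfter w (List.replicate (i + 1) a) n) {y : ℕ} (hy : y ≤ f d m - 1) :
    OccursAfter w (Ktail d m i ++ (delta d (m + 1) :: F d m).take y) (pos d w m (n + 1)) := by
  obtain ⟨P, hP1, hP2⟩ := exists_near_comm d m
  have hpos := length_Fpred_pos d m
  have hposF : 0 < f d m := length_F_pos d m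
  -- `P` has length `f_{d,m} + f_{d,m-1} - 2`, and `y ≤ f_{d,m} - 1` is the largest range for which
  -- the extended tail stays inside it. The right side is thus the same whichever letter follows the
  -- run.
  have hpre : (Fpred d m).dropLast ++ (delta d (m + 1) :: F d m).take y <+: P := by
    have h1 : Fpred d m ++ F d m =
        (Fpred d m).dropLast ++ (delta d (m + 1) :: F d m) := by
      conv_lhs => rw [Fpred_eq_dropLast d m]
      simp
    have h2 : (Fpred d m).dropLast ++ (delta d (m + 1) :: F d m).take y <+:
        Fpred d m ++ F d m := by
      rw [h1]
      exact (List.prefix_append_right_inj _).2 (List.take_prefix _ _)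
    refine List.prefix_of_prefix_length_le h2 (hP2 ▸ List.prefix_append _ _) ?_
    have h3 := congrArg List.length hP2
    simp only [List.length_append, List.length_cons, List.length_nil, length_F] at h3
    simp only [List.length_append, List.length_dropLast, List.length_take, List.length_cons,
      length_F]
    omega
  rw [List.replicate_succ, occursAfter_cons] at h
  rw [Ktail, List.append_assoc, occursAfter_append, flatten_replicate_F, ← pos_add m h.2]
  refine ⟨hw.occursAfter_subst m h.2, OccursAfter.of_prefix ?_ hpre⟩
  generalize n + 1 + (List.replicate i a).length = q
  rcases (w q).eq_a_or_b with hq | hq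
  · have h4 : OccursAfter w (F d m ++ Fpred d m) (pos d w m q) := by
      rw [occursAfter_append, ← pos_succ_of_a m hq]
      refine ⟨hw.occursAfter_F m hq, ?_⟩
      rcases (w (q + 1)).eq_a_or_b with hq' | hq'
      · exact (hw.occursAfter_F m hq').of_prefix (Fpred_prefix_F d m (by omega) hm)
      · exact hw.occursAfter_Fpred m hq'
    exact h4.of_prefix (hP1 ▸ List.prefix_append _ _)
  · have h4 : OccursAfter w (Fpred d m ++ F d m) (pos d w m q) := by
      rw [occursAfter_append, ← pos_succ_of_b m hq]
      exact ⟨hw.occursAfter_Fpred m hq, hw.occursAfter_F m (hw.apply_succ_of_b (by omega) hq)⟩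
    exact h4.of_prefix (hP2 ▸ List.prefix_append _ _)

theorem HasExpr.length_add {u : List Letter} {x y : ℕ} (h : HasExpr d m i u x y) :
    u.length + x = (i + 1) * f d m + (Fpred d m).length + y := by
  obtain ⟨h1, h2, h3, rfl⟩ := h
  rw [add_mul]
  simp only [List.length_append, List.length_drop, List.length_dropLast, length_K,
    List.length_take, List.length_cons, length_F]
  omega

/-- The kernel fixes the place. Conversely the left part together with `δ_m` is a suffix of the
block `F_{d,m}`, and the right part is forced by `IsFixed.occursAfter_right`. -/
theorem IsFixed.occursAfter_expr (hd : 2 ≤ d) (hw : IsFixed d w) (hm : 1 ≤ m)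
    {u : List Letter} {x y : ℕ} (h : HasExpr d m i u x y) (t : ℕ) :
    OccursAfter w u t ↔ ∃ n, OccursAfter w (List.replicate (i + 1) a) n ∧
      t = pos d w m n + (x - 1) := by
  obtain ⟨h1, h2, h3, rfl⟩ := h
  have hL : ((F d m).dropLast.drop (x - 1)).length = f d m - x := by
    simp only [List.length_drop, List.length_dropLast, length_F]
    omega
  constructor
  · intro h
    rw [List.append_assoc, occursAfter_append, occursAfter_append, hL, hw.occursAfter_K hd] at h
    obtain ⟨n, hn, hs⟩ := h.2.1
    refine ⟨n, hn, ?_⟩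
    rw [pos_succ_of_a m (occursAfter_cons.1 hn).1, length_F] at hs
    omega
  · rintro ⟨n, hn, rfl⟩
    have ha := (occursAfter_cons.1 hn).1
    have hF : (F d m).drop (x - 1) = (F d m).dropLast.drop (x - 1) ++ [delta d m] := by
      conv_lhs => rw [F_eq_dropLast d m]
      rw [List.drop_append_of_le_length]
      simp only [List.length_dropLast, length_F]
      omega
    have hsplit : (F d m).dropLast.drop (x - 1) ++ K d m i ++
        (delta d (m + 1) :: F d m).take y = (F d m).drop (x - 1) ++
        (Ktail d m i ++ (delta d (m + 1) :: F d m).take y) := by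
      rw [hF, K_eq_cons]; simp
    rw [hsplit, occursAfter_append]
    refine ⟨(hw.occursAfter_F m ha).drop (by rw [length_F]; omega), ?_⟩
    have hr := hw.occursAfter_right hd hm hn h3
    rw [pos_succ_of_a m ha, length_F] at hr
    rw [List.length_drop, length_F, show pos d w m n + (x - 1) + (f d m - (x - 1)) =
      pos d w m n + f d m by omega]
    exact hr

/-- Maximality of the kernel bounds the extension: `f_{d,m}` further letters on either side would
complete `K_{d,m,i+1}` if the adjacent block comes from `a`, and `K_{d,m+1,0}` if it comes from `b`.
-/
theorem IsFixed.exists_expr (hd : 2 ≤ d) (hw : IsFixed d w) (hm : 1 ≤ m)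
    {u : List Letter} (hu : IsFactor w u) (hk : IsKer d u m i) : ∃ x y, HasExpr d m i u x y := by
  obtain ⟨t, ht⟩ := hu
  obtain ⟨hid, hK, hmax⟩ := hk
  obtain ⟨s, hs1, hs2, hs⟩ := ht.exists_of_isInfix hK
  obtain ⟨n, hn, hsn⟩ := (hw.occursAfter_K hd m i s).1 hs
  have ha : w n = a := (occursAfter_cons.1 hn).1
  have hF := length_F_pos d m
  rw [length_F] at hF
  have hsn' := hsn
  rw [pos_succ_of_a m ha, length_F] at hsn'
  have hlenK := length_K d m i
  have hlenK' := length_K d m (i + 1)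
  rw [add_mul, one_mul] at hlenK'
  rw [length_F] at hlenK hlenK'
  have hlenK1 := length_K d (m + 1) 0
  rw [zero_mul, zero_add, Fpred_succ, length_F] at hlenK1
  have no_next : ¬ K d m (i + 1) <:+: u := by
    intro h
    rcases Nat.lt_or_ge (i + 1) d with h' | h'
    · have := hmax m (i + 1) h' h
      omega
    -- At the last type, `K_{d,m,d}` is `K_{d,m+2,0}`, of order exceeding `m`.
    · obtain rfl : d = i + 1 := by omega
      rw [← K_add_two_zero] at h
      have := hmax (m + 2) 0 (by omega) h
      omega
  have no_succ : ¬ K d (m + 1) 0 <:+: u := fun h => by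
    have := hmax (m + 1) 0 (by omega) h
    omega
  -- A `b` at level `m` closes an image of `a`, so its block ends a block `F_{d,m+1}`, and
  -- `K_{d,m+1,0}`, of length `f_{d,m}`, starts at its last letter.
  have hK1 : ∀ q, w q = b → ∃ s', s' + 1 = pos d w m (q + 1) ∧
      OccursAfter w (K d (m + 1) 0) s' := by
    intro q hq
    obtain ⟨r, hr, -, hr'⟩ := hw.exists_of_b hq
    have h0 : 0 < pos d w m (q + 1) := by
      have := pos_strictMono d w m (Nat.succ_pos q)
      simpa using this
    refine ⟨pos d w m (q + 1) - 1, by omega, (hw.occursAfter_K hd _ _ _).2 ⟨r, ?_, ?_⟩⟩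
    · simpa using hr
    · rw [hw.pos_succ_left', ← hr']
      omega
  have hleft : s - t ≤ f d m - 1 := by
    by_contra hlt
    cases n with
    | zero => rw [pos_zero_right] at hsn'; omega
    | succ n =>
      rcases (w n).eq_a_or_b with h' | h'
      · refine no_next (ht.isInfix (s := s - f d m) ((hw.occursAfter_K hd _ _ _).2 ⟨n, ?_, ?_⟩)
          (by omega) (by omega))
        · rw [List.replicate_succ, occursAfter_cons]
          exact ⟨h', hn⟩
        · omega
      · obtain ⟨s', h1, h2⟩ := hK1 n h'
        exact no_succ (ht.isInfix h2 (by omega) (by omega))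
  have hright : t + u.length - (s + (K d m i).length) ≤ f d m - 1 := by
    by_contra hlt
    rcases (w (n + (i + 1))).eq_a_or_b with h' | h'
    · refine no_next (ht.isInfix (s := s) ((hw.occursAfter_K hd _ _ _).2 ⟨n, ?_, hsn⟩)
        (by omega) (by omega))
      rw [List.replicate_succ', occursAfter_append]
      simpa using ⟨hn, h'⟩
    · obtain ⟨s', h1, h2⟩ := hK1 _ h'
      rw [pos_succ_of_b m h', show n + (i + 1) = n + (List.replicate (i + 1) a).length by simp,
        pos_add m hn, ← flatten_replicate_F] at h1
      simp only [List.length_flatten, List.map_replicate, List.sum_replicate, smul_eq_mul,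
        length_F, add_mul, one_mul] at h1
      exact no_succ (ht.isInfix h2 (by omega) (by omega))
  have hex : HasExpr d m i ((F d m).dropLast.drop (f d m - (s - t) - 1) ++ K d m i ++
      (delta d (m + 1) :: F d m).take (t + u.length - (s + (K d m i).length)))
      (f d m - (s - t)) (t + u.length - (s + (K d m i).length)) :=
    ⟨by omega, by omega, hright, rfl⟩
  have hocc := (hw.occursAfter_expr hd hm hex t).2 ⟨n, hn, by omega⟩
  have hlen := hex.length_add
  rw [add_mul, one_mul] at hlen
  refine ⟨_, _, hex.1, hex.2.1, hex.2.2.1, ht.eq_of_length hocc ?_⟩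
  omega

/-! ### Gaps -/

/-- Two strictly increasing sequences with the same range coincide, so the list of occurrence places
is the enumeration by `runPos`. The index of `offset` starts at `1`. -/
theorem IsFixed.offset_eq (hd : 2 ≤ d) (hw : IsFixed d w) (hm : 1 ≤ m) (hi : i < d)
    {u : List Letter} {x y : ℕ} (h : HasExpr d m i u x y) (p : ℕ) :
    offset w u (p + 1) = pos d w m (runPos d w i p) + (x - 1) := by
  have hmono : StrictMono fun p => pos d w m (runPos d w i p) + (x - 1) :=
    ((pos_strictMono d w m).comp (runPos_strictMono d w i)).add_const _
  have hset : Set.ofPred (OccursAfter w u) =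
      Set.range fun p => pos d w m (runPos d w i p) + (x - 1) := by
    ext t
    rw [Set.mem_range]
    refine (hw.occursAfter_expr hd hm h t).trans ?_
    constructor
    · rintro ⟨n, hn, rfl⟩
      obtain ⟨p, rfl⟩ := (hw.occursAfter_replicate_iff hi n).1 hn
      exact ⟨p, rfl⟩
    · rintro ⟨p, rfl⟩
      exact ⟨_, (hw.occursAfter_replicate_iff hi _).2 ⟨p, rfl⟩, rfl⟩
  have hinf : (Set.ofPred (OccursAfter w u)).Infinite := by
    rw [hset]; exact Set.infinite_range_of_injective hmono.injective
  have := (StrictMono.range_inj (Nat.nth_strictMono hinf) hmono).1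
    ((Nat.range_nth_of_infinite hinf).trans hset)
  exact congrFun this p

theorem IsFixed.offset_succ (hd : 2 ≤ d) (hw : IsFixed d w) (hm : 1 ≤ m) (hi : i < d)
    {u : List Letter} {x y : ℕ} (h : HasExpr d m i u x y) (p : ℕ) :
    offset w u (p + 2) = offset w u (p + 1) + ret d m i (sigmaInf (d - i - 1) w p) := by
  rw [hw.offset_eq hd hm hi h, hw.offset_eq hd hm hi h, hw.pos_runPos_succ hi]
  omega

/-- The signed length of a gap. -/
def Gap.len : Gap → ℤ
  | .empty => 0
  | .word u => u.length
  | .inv u => -u.length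

theorem len_gap (w : ℕ → Letter) (u : List Letter) (p : ℕ) :
    (gap w u p).len = offset w u (p + 1) - (offset w u p + u.length) := by
  unfold gap
  split_ifs with h1 h2
  · simp only [Gap.len]; omega
  · simp only [Gap.len, segment, List.length_map, List.length_range]; omega
  · simp only [Gap.len, segment, List.length_map, List.length_range]; omega

theorem sign_gap (w : ℕ → Letter) (u : List Letter) (p : ℕ) :
    (gap w u p).sign =
      Int.sign ((offset w u (p + 1) : ℤ) - (offset w u p + u.length)) := by
  unfold gap
  split_ifs with h1 h2
  · rw [Int.sign_eq_zero_iff_zero.2 (by omega)]; rfl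
  · rw [Int.sign_eq_one_of_pos (by omega)]; rfl
  · rw [Int.sign_eq_neg_one_of_neg (by omega)]; rfl

theorem OccursAfter.segment_eq {w : ℕ → Letter} {v : List Letter} {s s' : ℕ}
    (h : OccursAfter w v s) (h' : OccursAfter w v s') (i j : ℕ) (hj : j ≤ v.length) :
    segment w (s + i) (s + j) = segment w (s' + i) (s' + j) := by
  rw [occursAfter_iff] at h h'
  unfold segment
  rw [show s + j - (s + i) = s' + j - (s' + i) by omega]
  apply List.map_congr_left
  intro k hk
  rw [List.mem_range] at hk
  have hk' : i + k < v.length := by omega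
  have h1 := h (i + k) hk'
  have h2 := h' (i + k) hk'
  rw [← add_assoc] at h1 h2
  rw [h1, h2]

theorem IsFixed.occursAfter_offset (hd : 2 ≤ d) (hw : IsFixed d w) (hm : 1 ≤ m) (hi : i < d)
    {u : List Letter} {x y : ℕ} (h : HasExpr d m i u x y) (p : ℕ) :
    OccursAfter w u (offset w u (p + 1)) :=
  (hw.occursAfter_expr hd hm h _).2
    ⟨_, (hw.occursAfter_replicate_iff hi _).2 ⟨p, rfl⟩, hw.offset_eq hd hm hi h p⟩

/-- `G_B` compares gaps as words, so equal lengths are not enough. A positive gap lies inside the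
return word followed by `F_{d,m}`, a negative one inside `u`, and both are determined by the coding
letter. -/
theorem IsFixed.gap_eq (hd : 2 ≤ d) (hw : IsFixed d w) (hm : 1 ≤ m) (hi : i < d)
    {u : List Letter} {x y : ℕ} (h : HasExpr d m i u x y) {p q : ℕ}
    (hpq : sigmaInf (d - i - 1) w p = sigmaInf (d - i - 1) w q) :
    gap w u (p + 1) = gap w u (q + 1) := by
  unfold gap
  have h1 := hw.offset_succ hd hm hi h p
  have h2 := hw.offset_succ hd hm hi h q
  rw [← hpq] at h2
  rw [h1, h2]
  have hret := hw.occursAfter_return hi m p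
  have hret' := hw.occursAfter_return hi m q
  rw [← hpq] at hret'
  have e1 := hw.offset_eq hd hm hi h p
  have e2 := hw.offset_eq hd hm hi h q
  set R := ret d m i (sigmaInf (d - i - 1) w p) with hR
  split_ifs with h3 h4 h5 h6 h7 h8
  any_goals omega
  · rfl
  · congr 1
    have := hret.segment_eq hret' (x - 1 + u.length) (x - 1 + R) (by
      have := h.2.1
      rw [List.length_append, length_subst_tau, length_F]; omega)
    rw [e1, e2]
    simpa only [add_assoc] using this
  · congr 1
    exact (hw.occursAfter_offset hd hm hi h p).segment_eq (hw.occursAfter_offset hd hm hi h q)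
      R u.length le_rfl

end Fixed

theorem ret_a_lt_ret_b (d m i : ℕ) : ret d m i a < ret d m i b := by
  have := length_Fpred_pos d m
  simp only [ret]
  nlinarith [length_F_pos d m]

section Gaps

variable {d : ℕ} {w : ℕ → Letter} {m i : ℕ} {u : List Letter} {x y : ℕ}

theorem IsFixed.sign_gap (hd : 2 ≤ d) (hw : IsFixed d w) (hm : 1 ≤ m) (hi : i < d)
    (h : HasExpr d m i u x y) (p : ℕ) : (gap w u (p + 1)).sign =
      Int.sign ((ret d m i (sigmaInf (d - i - 1) w p) : ℤ) - u.length) := by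
  rw [CutSeq.sign_gap, hw.offset_succ hd hm hi h]
  congr 1
  push_cast
  ring

theorem IsFixed.gap_eq_iff (hd : 2 ≤ d) (hw : IsFixed d w) (hm : 1 ≤ m) (hi : i < d)
    (h : HasExpr d m i u x y) (p q : ℕ) : gap w u (p + 1) = gap w u (q + 1) ↔
      sigmaInf (d - i - 1) w p = sigmaInf (d - i - 1) w q := by
  refine ⟨fun hg => ?_, hw.gap_eq hd hm hi h⟩
  have h1 := congrArg Gap.len hg
  rw [len_gap, len_gap, hw.offset_succ hd hm hi h, hw.offset_succ hd hm hi h] at h1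
  have := ret_a_lt_ret_b d m i
  rcases (sigmaInf (d - i - 1) w p).eq_a_or_b with h2 | h2 <;>
    rcases (sigmaInf (d - i - 1) w q).eq_a_or_b with h3 | h3 <;>
    rw [h2, h3] at h1 ⊢ <;> omega

/-- There are only two gaps, one per coding letter: `G_A` belongs to the first letter of the coding
sequence and `G_B` to the other one. -/
theorem IsFixed.sign_gapA_gapB (hd : 2 ≤ d) (hw : IsFixed d w) (hm : 1 ≤ m) (hi : i < d)
    (h : HasExpr d m i u x y) {c c' : Letter} (hcc : c ≠ c')
    (h0 : sigmaInf (d - i - 1) w 0 = c) (h1 : ∃ p, sigmaInf (d - i - 1) w p = c') :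
    (gapA w u).sign = Int.sign ((ret d m i c : ℤ) - u.length) ∧
      (gapB w u).sign = Int.sign ((ret d m i c' : ℤ) - u.length) := by
  refine ⟨by rw [gapA, hw.sign_gap hd hm hi h, h0], ?_⟩
  have hne : {p | 1 ≤ p ∧ gap w u p ≠ gap w u 1}.Nonempty := by
    obtain ⟨p, hp⟩ := h1
    refine ⟨p + 1, by omega, fun hg => hcc ?_⟩
    rw [← h0, ← hp]
    exact ((hw.gap_eq_iff hd hm hi h p 0).1 hg).symm
  obtain ⟨h2, h3⟩ := Nat.sInf_mem hne
  rw [gapB]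
  obtain ⟨q, hq⟩ := Nat.exists_eq_add_of_le' h2
  rw [hq] at h3 ⊢
  rw [hw.sign_gap hd hm hi h]
  have h4 : sigmaInf (d - i - 1) w q ≠ c := fun h5 =>
    h3 ((hw.gap_eq_iff hd hm hi h q 0).2 (h5.trans h0.symm))
  have h5 : sigmaInf (d - i - 1) w q = c' := by
    revert h4 hcc
    generalize sigmaInf (d - i - 1) w q = e
    cases e <;> cases c <;> cases c' <;> simp
  rw [h5]

end Gaps

/-! ### The index sets -/

/-- For `i = d - 1` the coding sequence is `F_{d,∞}` with its letters exchanged, while `Γ_{d-1,γ}`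
refers to `F_{d,∞}` itself. -/
theorem sigmaInf_zero_eq_a_iff (w : ℕ → Letter) (n : ℕ) : sigmaInf 0 w n = a ↔ w n = b := by
  have hl : (List.range n).flatMap (fun k => sigma 0 (w k)) =
      (List.range n).map (fun k => (sigma 0 (w k)).headD a) := by
    rw [List.map_eq_flatMap]
    congr 1
    funext k
    cases w k <;> rfl
  have : sigmaInf 0 w n = (sigma 0 (w n)).headD a := by
    rw [sigmaInf, List.range_succ, List.map_append, List.flatMap_append, List.flatMap_map, hl,
      List.getD_eq_getElem?_getD, List.getElem?_append_right (by simp)]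
    cases h : w n <;> simp [sigma, h]
  rw [this]
  cases w n <;> simp [sigma]

theorem IsFixed.apply_zero {d : ℕ} {w : ℕ → Letter} (hd : 1 ≤ d) (hw : IsFixed d w) :
    w 0 = a ∧ w d = b := by
  have h := hw.apply_pos hd 0
  rw [pos_zero_right] at h
  have h' := (hw.block_a h).2
  rw [pos_zero_right, zero_add] at h'
  exact ⟨h, h'⟩

theorem sigmaInf_zero_and_self {k : ℕ} (hk : 1 ≤ k) {w : ℕ → Letter} (h : w 0 = a) :
    sigmaInf k w 0 = a ∧ sigmaInf k w k = b := by
  have h1 := pre_sigmaInf k w 1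
  have h2 : (pre w 1).flatMap (sigma k) = List.replicate k a ++ [b] := by
    simp [pre_succ, h, sigma]
  have h3 : OccursAfter (sigmaInf k w) (List.replicate k a ++ [b]) 0 := by
    rw [occursAfter_iff_pre, ← h2, pre_zero, List.nil_append, zero_add, h1]
  rw [occursAfter_append, occursAfter_replicate] at h3
  exact ⟨by simpa using h3.1 0 hk, by simpa using h3.2⟩

theorem mem_Gam {d i p : ℕ} {γ : Letter} (h : i ≠ d - 1) :
    p ∈ Gam d i γ ↔ 1 ≤ p ∧ sigmaInf (d - i - 1) (Finf d) (p - 1) = γ := by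
  rw [Gam, if_neg h]; rfl

theorem mem_Gam_last_a {d p : ℕ} :
    p ∈ Gam d (d - 1) a ↔ 1 ≤ p ∧ sigmaInf (d - (d - 1) - 1) (Finf d) (p - 1) = b := by
  rw [Gam, if_pos rfl, show d - (d - 1) - 1 = 0 by omega]
  have := sigmaInf_zero_eq_a_iff (Finf d) (p - 1)
  refine and_congr_right fun _ => ?_
  revert this
  cases sigmaInf 0 (Finf d) (p - 1) <;> cases Finf d (p - 1) <;> simp

theorem mem_Gam_last_b {d p : ℕ} :
    p ∈ Gam d (d - 1) b ↔ 1 ≤ p ∧ sigmaInf (d - (d - 1) - 1) (Finf d) (p - 1) = a := by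
  rw [Gam, if_pos rfl, show d - (d - 1) - 1 = 0 by omega, sigmaInf_zero_eq_a_iff]
  rfl

/-! ### Types and gaps of a factor -/

theorem IsKer.unique {d m i j : ℕ} {u : List Letter} (hi : IsKer d u m i) (hj : IsKer d u m j) :
    i = j := by
  have h1 := hi.2.2 m j hj.1 hj.2.1
  have h2 := hj.2.2 m i hi.1 hi.2.1
  omega

section Types

variable {d m i : ℕ} {u : List Letter} {x y : ℕ}

theorem ret_sub_length (hm : 1 ≤ m) (h : HasExpr d m i u x y) :
    (ret d m i a : ℤ) - u.length = (x : ℤ) - y - i * f d m - f d (m - 1) ∧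
      (ret d m i b : ℤ) - u.length = (x : ℤ) - y := by
  have h1 := h.length_add
  rw [length_Fpred d hm] at h1
  simp only [ret, length_F, length_Fpred d hm]
  zify at h1
  push_cast
  constructor <;> linarith

theorem mem_signType (hu : IsFactor (Finf d) u) (hk : IsKer d u m i) (j : ℕ) (sA sB : ℤ) :
    u ∈ signType d m j sA sB ↔
      j = i ∧ (gapA (Finf d) u).sign = sA ∧ (gapB (Finf d) u).sign = sB := by
  constructor
  · rintro ⟨-, h1, h2⟩
    exact ⟨h1.unique hk, h2⟩
  · rintro ⟨rfl, h⟩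
    exact ⟨hu, hk, h⟩

theorem sign_gaps (hd : 2 ≤ d) (hm : 1 ≤ m) (hi : i + 1 < d) (h : HasExpr d m i u x y) :
    (gapA (Finf d) u).sign = Int.sign ((x : ℤ) - y - i * f d m - f d (m - 1)) ∧
      (gapB (Finf d) u).sign = Int.sign ((x : ℤ) - y) := by
  have hw := isFixed_Finf (d := d) (by omega)
  obtain ⟨h1, h2⟩ := ret_sub_length hm h
  rw [← h1, ← h2]
  have h3 := sigmaInf_zero_and_self (k := d - i - 1) (by omega) (hw.apply_zero (by omega)).1
  exact hw.sign_gapA_gapB hd hm (by omega) h (by simp) h3.1 ⟨_, h3.2⟩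

theorem sign_gaps_last (hd : 2 ≤ d) (hm : 1 ≤ m) (h : HasExpr d m (d - 1) u x y) :
    (gapA (Finf d) u).sign = Int.sign ((x : ℤ) - y) ∧
      (gapB (Finf d) u).sign =
        Int.sign ((x : ℤ) - y - (d - 1 : ℕ) * f d m - f d (m - 1)) := by
  have hw := isFixed_Finf (d := d) (by omega)
  obtain ⟨h1, h2⟩ := ret_sub_length hm h
  rw [← h1, ← h2]
  obtain ⟨h3, h4⟩ := hw.apply_zero (by omega)
  refine hw.sign_gapA_gapB hd hm (by omega) h (by simp) ?_ ⟨d, ?_⟩ <;>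
    rw [show d - (d - 1) - 1 = 0 by omega]
  · have := sigmaInf_zero_eq_a_iff (Finf d) 0
    rw [h3] at this
    revert this
    cases sigmaInf 0 (Finf d) 0 <;> simp
  · rw [sigmaInf_zero_eq_a_iff, h4]

/-- The signed distance between the occurrences number `p` and `p + 1`. -/
theorem offset_sub (hd : 2 ≤ d) (hm : 1 ≤ m) (hi : i < d) (h : HasExpr d m i u x y)
    {p : ℕ} (hp : 1 ≤ p) :
    sigmaInf (d - i - 1) (Finf d) (p - 1) = a ∧
      (offset (Finf d) u (p + 1) : ℤ) - (offset (Finf d) u p + u.length) =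
        (x : ℤ) - y - i * f d m - f d (m - 1) ∨
    sigmaInf (d - i - 1) (Finf d) (p - 1) = b ∧
      (offset (Finf d) u (p + 1) : ℤ) - (offset (Finf d) u p + u.length) = (x : ℤ) - y := by
  have hw := isFixed_Finf (d := d) (by omega)
  obtain ⟨q, rfl⟩ := Nat.exists_eq_add_of_le' hp
  have h1 : offset (Finf d) u (q + 1 + 1) = _ := hw.offset_succ hd hm hi h q
  obtain ⟨h2, h3⟩ := ret_sub_length hm h
  rw [Nat.add_sub_cancel]
  rcases (sigmaInf (d - i - 1) (Finf d) q).eq_a_or_b with hz | hz <;> rw [hz] at h1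
  · left; exact ⟨hz, by omega⟩
  · right; exact ⟨hz, by omega⟩

theorem f_pos (d m : ℕ) : 0 < f d m := length_F_pos d m

theorem HasExpr.bounds (h : HasExpr d m i u x y) :
    (1 : ℤ) ≤ x ∧ (x : ℤ) ≤ f d m ∧ (0 : ℤ) ≤ y ∧ (y : ℤ) ≤ f d m - 1 := by
  obtain ⟨h1, h2, h3, -⟩ := h
  have := f_pos d m
  omega

/-- For `i ≥ 1` the short return distance `f_{d,m}` is less than `|u|`, so a coding letter `a`
always produces an overlap. -/
theorem sign_short (h : HasExpr d m i u x y) (hi : 1 ≤ i) :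
    (x : ℤ) - y - i * f d m - f d (m - 1) < 0 := by
  obtain ⟨h1, h2, h3, h4⟩ := h.bounds
  have h5 : (0 : ℤ) < f d (m - 1) := by exact_mod_cast f_pos d (m - 1)
  have h6 : (1 : ℤ) ≤ i := by exact_mod_cast hi
  nlinarith

/-- Only the signs carry information; the outer bounds `f_{d,m}` and `2 - f_{d,m}` hold for every
expression by the ranges of `x` and `y`. -/
theorem types_zero (hd : 2 ≤ d) (hm : 1 ≤ m) (hu : IsFactor (Finf d) u) (hk : IsKer d u m 0)
    (h : HasExpr d m 0 u x y) :
    (u ∈ T01 d m ↔ (f d (m - 1) : ℤ) < (x : ℤ) - y ∧ (x : ℤ) - y ≤ f d m) ∧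
    (u ∈ T02 d m ↔ (x : ℤ) - y = f d (m - 1)) ∧
    (u ∈ T03 d m ↔ 0 < (x : ℤ) - y ∧ (x : ℤ) - y < f d (m - 1)) ∧
    (u ∈ T04 d m ↔ (x : ℤ) - y = 0) ∧
    (u ∈ T05 d m ↔ 2 - (f d m : ℤ) ≤ (x : ℤ) - y ∧ (x : ℤ) - y < 0) := by
  obtain ⟨h1, h2⟩ := sign_gaps hd hm (by omega) h
  have h3 := h.bounds
  have h4 := f_pos d (m - 1)
  simp only [T01, T02, T03, T04, T05, mem_signType hu hk, h1, h2, true_and, Nat.cast_zero, zero_mul,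
    sub_zero, Int.sign_eq_one_iff_pos, Int.sign_eq_neg_one_iff_neg, Int.sign_eq_zero_iff_zero]
  omega

theorem types_middle (hd : 2 ≤ d) (hm : 1 ≤ m) (hi : 1 ≤ i) (hi' : i ≤ d - 2)
    (hu : IsFactor (Finf d) u) (hk : IsKer d u m i) (h : HasExpr d m i u x y) :
    (u ∈ Ti1 d m i ↔ 0 < (x : ℤ) - y ∧ (x : ℤ) - y ≤ f d m) ∧
    (u ∈ Ti2 d m i ↔ (x : ℤ) - y = 0) ∧
    (u ∈ Ti3 d m i ↔ 2 - (f d m : ℤ) ≤ (x : ℤ) - y ∧ (x : ℤ) - y < 0) := by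
  obtain ⟨h1, h2⟩ := sign_gaps hd hm (by omega) h
  have h3 := h.bounds
  have h5 := sign_short h hi
  simp only [Ti1, Ti2, Ti3, mem_signType hu hk, h1, h2, true_and,
    Int.sign_eq_one_iff_pos, Int.sign_eq_neg_one_iff_neg, Int.sign_eq_zero_iff_zero, h5]
  omega

theorem types_last (hd : 2 ≤ d) (hm : 1 ≤ m)
    (hu : IsFactor (Finf d) u) (hk : IsKer d u m (d - 1)) (h : HasExpr d m (d - 1) u x y) :
    (u ∈ Td1 d m ↔ 0 < (x : ℤ) - y ∧ (x : ℤ) - y ≤ f d m) ∧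
    (u ∈ Td2 d m ↔ (x : ℤ) - y = 0) ∧
    (u ∈ Td3 d m ↔ 2 - (f d m : ℤ) ≤ (x : ℤ) - y ∧ (x : ℤ) - y < 0) := by
  obtain ⟨h1, h2⟩ := sign_gaps_last hd hm h
  have h3 := h.bounds
  have h5 := sign_short h (by omega)
  simp only [Td1, Td2, Td3, mem_signType hu hk, h1, h2, true_and, and_true,
    Int.sign_eq_one_iff_pos, Int.sign_eq_neg_one_iff_neg, Int.sign_eq_zero_iff_zero, h5]
  omega

end Types

/-! ### Adjacent, separated and overlapped occurrences -/

section Pairs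

variable {d m : ℕ} {u : List Letter} {p : ℕ}

theorem mem_T_prod_Gam {j i : ℕ} {sA sB : ℤ} {γ : Letter}
    (h : (u, p) ∈ signType d m j sA sB ×ˢ Gam d i γ) :
    IsFactor (Finf d) u ∧ (∃ i, IsKer d u m i) ∧ 1 ≤ p :=
  ⟨h.1.1, ⟨j, h.1.2.1⟩, h.2.1⟩

/-- The gaps of a factor are determined by the types and the index sets. -/
theorem pairs_iff (hd : 2 ≤ d) (hm : 1 ≤ m) (hu : IsFactor (Finf d) u) {i : ℕ}
    (hk : IsKer d u m i) (hp : 1 ≤ p) :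
    (Adjacent (Finf d) u p ↔
      (u, p) ∈ T02 d m ×ˢ Gam d 0 a ∪ T04 d m ×ˢ Gam d 0 b ∪
        (⋃ i ∈ Set.Icc 1 (d - 2), Ti2 d m i ×ˢ Gam d i b) ∪ Td2 d m ×ˢ Gam d (d - 1) a) ∧
    (Separated (Finf d) u p ↔
      (u, p) ∈ T01 d m ×ˢ allIdx ∪ (T02 d m ∪ T03 d m) ×ˢ Gam d 0 b ∪
        (⋃ i ∈ Set.Icc 1 (d - 2), Ti1 d m i ×ˢ Gam d i b) ∪ Td1 d m ×ˢ Gam d (d - 1) a) ∧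
    (Overlapped (Finf d) u p ↔
      (u, p) ∈ (T03 d m ∪ T04 d m) ×ˢ Gam d 0 a ∪
        (⋃ i ∈ Set.Icc 1 (d - 2), (Ti1 d m i ∪ Ti2 d m i) ×ˢ Gam d i a) ∪
        ((⋃ i ∈ Set.Icc 1 (d - 2), Ti3 d m i) ∪ T05 d m ∪ Td3 d m) ×ˢ allIdx ∪
        (Td1 d m ∪ Td2 d m) ×ˢ Gam d (d - 1) b) := by
  have hid := hk.1
  obtain ⟨x, y, h⟩ := (isFixed_Finf (d := d) (by omega)).exists_expr hd hm hu hk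
  have hoff := offset_sub hd hm hid h hp
  have hb := h.bounds
  have hf := f_pos d (m - 1)
  have hadj : Adjacent (Finf d) u p ↔ (offset (Finf d) u (p + 1) : ℤ) -
      (offset (Finf d) u p + u.length) = 0 := by unfold Adjacent; omega
  have hsep : Separated (Finf d) u p ↔ 0 < (offset (Finf d) u (p + 1) : ℤ) -
      (offset (Finf d) u p + u.length) := by unfold Separated; omega
  have hover : Overlapped (Finf d) u p ↔ (offset (Finf d) u (p + 1) : ℤ) -
      (offset (Finf d) u p + u.length) < 0 := by unfold Overlapped; omega
  rw [hadj, hsep, hover]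
  have hall : p ∈ allIdx := hp
  -- From here on only the coding letter and the integer `D` matter; each case on `i` is linear
  -- arithmetic in `x - y`.
  generalize (offset (Finf d) u (p + 1) : ℤ) - (offset (Finf d) u p + u.length) = D at hoff
  simp only [Set.mem_union, Set.mem_prod, Set.mem_iUnion, Set.mem_Icc, hall, and_true]
  rcases Nat.eq_zero_or_pos i with rfl | hi
  · obtain ⟨h1, h2⟩ := sign_gaps hd hm (by omega) h
    have e1 : ∀ j, ¬ ((1 ≤ j ∧ j ≤ d - 2) ∧ j = 0) := by omega
    have e2 : d - 1 ≠ 0 := by omega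
    rw [Nat.cast_zero, zero_mul, sub_zero] at hoff h1
    simp only [T01, T02, T03, T04, T05, Ti1, Ti2, Ti3, Td1, Td2, Td3, mem_signType hu hk, h1, h2,
      mem_Gam (show 0 ≠ d - 1 by omega), hp, true_and, e2, false_and, or_false,
      Int.sign_eq_one_iff_pos, Int.sign_eq_neg_one_iff_neg, Int.sign_eq_zero_iff_zero,
      ← and_assoc, exists_prop, e1, exists_false, false_or]
    rcases hoff with ⟨hz, rfl⟩ | ⟨hz, rfl⟩ <;>
      simp only [hz, and_true, and_false, reduceCtorEq, or_false, false_or] <;> omega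
  · have e0 : ¬ 0 = i := by omega
    have hs := sign_short h hi
    rcases Nat.lt_or_ge i (d - 1) with hi' | hi'
    · obtain ⟨h1, h2⟩ := sign_gaps hd hm (by omega) h
      have e1 : ∀ j, (1 ≤ j ∧ j ≤ d - 2) ∧ j = i ↔ j = i := by omega
      have e2 : d - 1 ≠ i := by omega
      simp only [T01, T02, T03, T04, T05, Ti1, Ti2, Ti3, Td1, Td2, Td3, mem_signType hu hk, h1, h2,
        e2, e0, false_and, or_false, false_or, ← and_or_left,
        Int.sign_eq_one_iff_pos, Int.sign_eq_neg_one_iff_neg, Int.sign_eq_zero_iff_zero,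
        ← and_assoc, exists_prop, e1]
      simp only [and_assoc, exists_eq_left, mem_Gam (show i ≠ d - 1 by omega), hp, true_and, hs]
      rcases hoff with ⟨hz, rfl⟩ | ⟨hz, rfl⟩ <;>
        simp only [hz, and_true, and_false, reduceCtorEq, iff_false, false_or] <;> omega
    · obtain rfl : i = d - 1 := by omega
      obtain ⟨h1, h2⟩ := sign_gaps_last hd hm h
      have e1 : ∀ j, ¬ ((1 ≤ j ∧ j ≤ d - 2) ∧ j = d - 1) := by omega
      simp only [T01, T02, T03, T04, T05, Ti1, Ti2, Ti3, Td1, Td2, Td3, mem_signType hu hk, h1, h2,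
        e0, true_and, false_and, or_false, false_or, ← and_or_left,
        Int.sign_eq_one_iff_pos, Int.sign_eq_neg_one_iff_neg, Int.sign_eq_zero_iff_zero,
        ← and_assoc, exists_prop, e1, exists_false, hs, and_true, mem_Gam_last_a, mem_Gam_last_b,
        hp]
      rcases hoff with ⟨hz, rfl⟩ | ⟨hz, rfl⟩ <;>
        simp only [hz, and_true, and_false, reduceCtorEq, iff_false, or_false] <;> omega

theorem pairs_subset {X : Set (List Letter × ℕ)} {R : List Letter → ℕ → Prop}
    (hX : ∀ q ∈ X, IsFactor (Finf d) q.1 ∧ (∃ i, IsKer d q.1 m i) ∧ 1 ≤ q.2)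
    (h : ∀ u p i, IsFactor (Finf d) u → IsKer d u m i → 1 ≤ p → (R u p ↔ (u, p) ∈ X)) :
    {q | IsFactor (Finf d) q.1 ∧ 1 ≤ q.2 ∧ R q.1 q.2} ∩ kerOrder d m = X := by
  ext ⟨u, p⟩
  constructor
  · rintro ⟨⟨h1, h2, h3⟩, i, h4⟩
    exact (h u p i h1 h4 h2).1 h3
  · intro hq
    obtain ⟨h1, ⟨i, h2⟩, h3⟩ := hX _ hq
    exact ⟨⟨h1, h3, (h u p i h1 h2 h3).2 hq⟩, i, h2⟩

end Pairs

end CutSeq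

theorem mainTheorem9 (d : ℕ) (hd : 2 ≤ d) (m : ℕ) (hm : 1 ≤ m) :
    -- the pairs with adjacent, separated, overlapped consecutive occurrences
    (CutSeq.P1 d ∩ CutSeq.kerOrder d m =
      CutSeq.T02 d m ×ˢ CutSeq.Gam d 0 .a ∪ CutSeq.T04 d m ×ˢ CutSeq.Gam d 0 .b ∪
      (⋃ i ∈ Set.Icc 1 (d - 2), CutSeq.Ti2 d m i ×ˢ CutSeq.Gam d i .b) ∪
      CutSeq.Td2 d m ×ˢ CutSeq.Gam d (d - 1) .a) ∧
    (CutSeq.S1 d ∩ CutSeq.kerOrder d m =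
      CutSeq.T01 d m ×ˢ CutSeq.allIdx ∪
      (CutSeq.T02 d m ∪ CutSeq.T03 d m) ×ˢ CutSeq.Gam d 0 .b ∪
      (⋃ i ∈ Set.Icc 1 (d - 2), CutSeq.Ti1 d m i ×ˢ CutSeq.Gam d i .b) ∪
      CutSeq.Td1 d m ×ˢ CutSeq.Gam d (d - 1) .a) ∧
    (CutSeq.O1 d ∩ CutSeq.kerOrder d m =
      (CutSeq.T03 d m ∪ CutSeq.T04 d m) ×ˢ CutSeq.Gam d 0 .a ∪
      (⋃ i ∈ Set.Icc 1 (d - 2),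
        (CutSeq.Ti1 d m i ∪ CutSeq.Ti2 d m i) ×ˢ CutSeq.Gam d i .a) ∪
      ((⋃ i ∈ Set.Icc 1 (d - 2), CutSeq.Ti3 d m i) ∪ CutSeq.T05 d m ∪ CutSeq.Td3 d m) ×ˢ
        CutSeq.allIdx ∪
      (CutSeq.Td1 d m ∪ CutSeq.Td2 d m) ×ˢ CutSeq.Gam d (d - 1) .b) ∧
    -- the types through the value of `x - y` in the expression of the factor
    (∀ (u : List CutSeq.Letter) (i : ℕ),
      CutSeq.IsFactor (CutSeq.Finf d) u → CutSeq.IsKer d u m i →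
        ∃ x y : ℕ, CutSeq.HasExpr d m i u x y) ∧
    (∀ (u : List CutSeq.Letter) (x y : ℕ),
      CutSeq.IsFactor (CutSeq.Finf d) u → CutSeq.IsKer d u m 0 → CutSeq.HasExpr d m 0 u x y →
        (u ∈ CutSeq.T01 d m ↔
          (CutSeq.f d (m - 1) : ℤ) < (x : ℤ) - y ∧ (x : ℤ) - y ≤ CutSeq.f d m) ∧
        (u ∈ CutSeq.T02 d m ↔ (x : ℤ) - y = CutSeq.f d (m - 1)) ∧
        (u ∈ CutSeq.T03 d m ↔ 0 < (x : ℤ) - y ∧ (x : ℤ) - y < CutSeq.f d (m - 1)) ∧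
        (u ∈ CutSeq.T04 d m ↔ (x : ℤ) - y = 0) ∧
        (u ∈ CutSeq.T05 d m ↔ 2 - (CutSeq.f d m : ℤ) ≤ (x : ℤ) - y ∧ (x : ℤ) - y < 0)) ∧
    (∀ (i : ℕ) (u : List CutSeq.Letter) (x y : ℕ), 1 ≤ i → i ≤ d - 2 →
      CutSeq.IsFactor (CutSeq.Finf d) u → CutSeq.IsKer d u m i → CutSeq.HasExpr d m i u x y →
        (u ∈ CutSeq.Ti1 d m i ↔ 0 < (x : ℤ) - y ∧ (x : ℤ) - y ≤ CutSeq.f d m) ∧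
        (u ∈ CutSeq.Ti2 d m i ↔ (x : ℤ) - y = 0) ∧
        (u ∈ CutSeq.Ti3 d m i ↔ 2 - (CutSeq.f d m : ℤ) ≤ (x : ℤ) - y ∧ (x : ℤ) - y < 0)) ∧
    (∀ (u : List CutSeq.Letter) (x y : ℕ),
      CutSeq.IsFactor (CutSeq.Finf d) u → CutSeq.IsKer d u m (d - 1) →
        CutSeq.HasExpr d m (d - 1) u x y →
        (u ∈ CutSeq.Td1 d m ↔ 0 < (x : ℤ) - y ∧ (x : ℤ) - y ≤ CutSeq.f d m) ∧
        (u ∈ CutSeq.Td2 d m ↔ (x : ℤ) - y = 0) ∧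
        (u ∈ CutSeq.Td3 d m ↔ 2 - (CutSeq.f d m : ℤ) ≤ (x : ℤ) - y ∧ (x : ℤ) - y < 0)) := by
  have hw := CutSeq.isFixed_Finf (d := d) (by omega)
  refine ⟨?_, ?_, ?_, fun u i hu hk => hw.exists_expr hd hm hu hk,
    fun u x y hu hk h => CutSeq.types_zero hd hm hu hk h,
    fun i u x y hi hi' hu hk h => CutSeq.types_middle hd hm hi hi' hu hk h,
    fun u x y hu hk h => CutSeq.types_last hd hm hu hk h⟩
  · refine CutSeq.pairs_subset ?_ fun u p i hu hk hp => (CutSeq.pairs_iff hd hm hu hk hp).1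
    rintro ⟨u, p⟩ hq
    simp only [Set.mem_union, Set.mem_iUnion, exists_prop] at hq
    rcases hq with ((hq | hq) | ⟨j, -, hq⟩) | hq <;> exact CutSeq.mem_T_prod_Gam hq
  · refine CutSeq.pairs_subset ?_ fun u p i hu hk hp => (CutSeq.pairs_iff hd hm hu hk hp).2.1
    rintro ⟨u, p⟩ hq
    simp only [Set.mem_union, Set.mem_iUnion, Set.mem_prod, exists_prop] at hq
    rcases hq with ((⟨hq, hp⟩ | ⟨hq | hq, hp⟩) | ⟨j, -, hq, hp⟩) | ⟨hq, hp⟩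
    · exact ⟨hq.1, ⟨_, hq.2.1⟩, hp⟩
    all_goals exact ⟨hq.1, ⟨_, hq.2.1⟩, hp.1⟩
  · refine CutSeq.pairs_subset ?_ fun u p i hu hk hp => (CutSeq.pairs_iff hd hm hu hk hp).2.2
    rintro ⟨u, p⟩ hq
    simp only [Set.mem_union, Set.mem_iUnion, Set.mem_prod, exists_prop] at hq
    rcases hq with ((⟨hq | hq, hp⟩ | ⟨j, -, hq | hq, hp⟩) | ⟨(⟨j, -, hq⟩ | hq) | hq, hp⟩) |
      ⟨hq | hq, hp⟩
    all_goals first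
      | exact ⟨hq.1, ⟨_, hq.2.1⟩, hp.1⟩
      | exact ⟨hq.1, ⟨_, hq.2.1⟩, hp⟩
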